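/- Let $1\le m\le n$ and let $\Lambda\subset\mathbb C^n$ be a discrete subgroup such that $X=\mathbb C^n/\Lambda$ is a Cousin group, i.e. every holomorphic function on $X$ is constant. Suppose that, in suitable complex linear coordinates of $\mathbb C^n$, $\Lambda$ is in normal form, i.e. generated by the columns of $$P=\begin{pmatrix}0 & I_m & M+\mathrm i N\\ I_{n-m} & R_1 & R_2\end{pmatrix},$$ where $M,N$ are real $m\times m$ matrices, $N$ is invertible, and $R=(R_1\ R_2)$ is a real $(n-m)\times 2m$ matrix. If $H^1(U,\mathcal O)$ is a finite dimensional complex vector space for every open subset $U\subset X$ whose inverse image in $\mathbb C^n$ is convex, then $\Lambda$ is strongly dispersive: for every $a\in(0,1)$ there is $C>0$ such that $$\|{}^t\sigma R+{}^t\tau\|\ \ge\ C\,a^{|\sigma|}\qquad\text{for all }\sigma\in\mathbb Z^{n-m}\setminus\{0\},\ \tau\in\mathbb Z^{2m}.$$ Here $\mathcal O$ is the sheaf of holomorphic functions on $X$, $H^1$ is sheaf cohomology, $|\sigma|=\sum_i|\sigma_i|$, and $\|\cdot\|$ is the maximum norm on $\mathbb R^{2m}$ (the condition does not depend on the choice of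 these norms). -/

import Mathlib

noncomputable section

open CategoryTheory TopologicalSpace Opposite

namespace CousinGroup

/-! ### The complex group `ℂⁿ/Λ`, its holomorphic functions and the cohomology of its open sets -/

/-- The quotient `ℂⁿ/Λ`, with the quotient topology. -/
abbrev GroupQuotient {n : ℕ} (Λ : AddSubgroup (Fin n → ℂ)) : Type := (Fin n → ℂ) ⧸ Λ

/-- The projection `ℂⁿ → ℂⁿ/Λ`. -/
def proj {n : ℕ} (Λ : AddSubgroup (Fin n → ℂ)) : (Fin n → ℂ) → GroupQuotient Λ :=
  fun z => QuotientAddGroup.mk z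

theorem continuous_proj {n : ℕ} (Λ : AddSubgroup (Fin n → ℂ)) : Continuous (proj Λ) :=
  continuous_quotient_mk'

/-- The `Λ`-periodic function `z ↦ f (z mod Λ)` on the inverse image of `V` in `ℂⁿ`
(extended by zero outside of that inverse image). -/
def lift {n : ℕ} (Λ : AddSubgroup (Fin n → ℂ)) {V : Opens (GroupQuotient Λ)} (f : V → ℂ) :
    (Fin n → ℂ) → ℂ :=
  fun z => Function.extend Subtype.val f 0 (proj Λ z)

theorem lift_apply {n : ℕ} (Λ : AddSubgroup (Fin n → ℂ)) {V : Opens (GroupQuotient Λ)} (f : V → ℂ)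
    {z : Fin n → ℂ} (hz : proj Λ z ∈ V) : lift Λ f z = f ⟨proj Λ z, hz⟩ :=
  Subtype.val_injective.extend_apply f 0 ⟨proj Λ z, hz⟩

/-- A function on an open set `V ⊆ ℂⁿ/Λ` is holomorphic when its pull-back to the inverse
image of `V` in `ℂⁿ` is holomorphic. -/
def IsHolomorphic {n : ℕ} (Λ : AddSubgroup (Fin n → ℂ)) {V : Opens (GroupQuotient Λ)} (f : V → ℂ) : Prop :=
  DifferentiableOn ℂ (lift Λ f) (proj Λ ⁻¹' (V : Set (GroupQuotient Λ)))

/-- The `ℂ`-vector space of holomorphic functions on the open set `V ⊆ ℂⁿ/Λ`. -/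
def holomorphic {n : ℕ} (Λ : AddSubgroup (Fin n → ℂ)) (V : Opens (GroupQuotient Λ)) :
    Submodule ℂ (V → ℂ) where
  carrier := {f | IsHolomorphic Λ f}
  add_mem' {f g} hf hg := (DifferentiableOn.add hf hg).congr fun z hz => by
    simp [lift_apply Λ _ hz]
  zero_mem' := (differentiableOn_const (0 : ℂ)).congr fun z hz => by
    simp [lift_apply Λ _ hz]
  smul_mem' c f hf := (DifferentiableOn.const_smul hf c).congr fun z hz => by
    simp [lift_apply Λ _ hz]

/-- Being holomorphic is a local condition. -/
def holomorphicLocal {n : ℕ} (Λ : AddSubgroup (Fin n → ℂ)) :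
    TopCat.LocalPredicate (X := TopCat.of (GroupQuotient Λ)) (fun _ => ℂ) where
  pred {V} f := IsHolomorphic Λ (V := V) f
  res {W V} i f hf := (hf.mono fun _ hz => i.le hz).congr fun z hz => by
    rw [lift_apply Λ _ hz, lift_apply Λ f (i.le hz)]; rfl
  locality {V} f h z hz := by
    obtain ⟨W, hW, i, hf⟩ := h ⟨proj Λ z, hz⟩
    have hopen : IsOpen (proj Λ ⁻¹' (W : Set (GroupQuotient Λ))) := W.isOpen.preimage (continuous_proj Λ)
    have hd := (hf z hW).differentiableAt (hopen.mem_nhds hW)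
    refine (hd.congr_of_eventuallyEq ?_).differentiableWithinAt
    filter_upwards [hopen.mem_nhds hW] with w hw
    rw [lift_apply Λ _ hw, lift_apply Λ f (i.le hw)]; rfl

/-- Restriction of holomorphic functions to a smaller open set. -/
def restrict {n : ℕ} (Λ : AddSubgroup (Fin n → ℂ)) {V W : Opens (GroupQuotient Λ)} (h : W ≤ V) :
    holomorphic Λ V →ₗ[ℂ] holomorphic Λ W where
  toFun f := ⟨fun x => f.1 ⟨x.1, h x.2⟩,
    (holomorphicLocal Λ).res (U := W) (V := V) (homOfLE h) f.1 f.2⟩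
  map_add' _ _ := rfl
  map_smul' _ _ := rfl

/-- The presheaf of abelian groups `V ↦ 𝒪(V)` on `ℂⁿ/Λ`. -/
def holomorphicPresheaf {n : ℕ} (Λ : AddSubgroup (Fin n → ℂ)) :
    TopCat.Presheaf AddCommGrpCat.{0} (TopCat.of (GroupQuotient Λ)) where
  obj V := AddCommGrpCat.of (holomorphic Λ V.unop)
  map i := AddCommGrpCat.ofHom (restrict Λ (leOfHom i.unop)).toAddMonoidHom
  map_id _ := rfl
  map_comp _ _ := rfl

/-- The structure sheaf `𝒪` of `ℂⁿ/Λ`: the sheaf of abelian groups of holomorphic functions. -/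
def structureSheaf {n : ℕ} (Λ : AddSubgroup (Fin n → ℂ)) :
    Sheaf (Opens.grothendieckTopology (TopCat.of (GroupQuotient Λ))) AddCommGrpCat.{0} where
  obj := holomorphicPresheaf Λ
  property := by
    rw [CategoryTheory.Presheaf.isSheaf_iff_isSheaf_forget _ _
      (CategoryTheory.forget AddCommGrpCat)]
    exact (TopCat.subsheafToTypes (holomorphicLocal Λ)).property

/-- Multiplication by the complex number `c`, as an endomorphism of the sheaf `𝒪`. -/
def scalar {n : ℕ} (Λ : AddSubgroup (Fin n → ℂ)) (c : ℂ) :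
    structureSheaf Λ ⟶ structureSheaf Λ :=
  CategoryTheory.ObjectProperty.homMk
    { app := fun V => AddCommGrpCat.ofHom
        (LinearMap.lsmul ℂ (holomorphic Λ V.unop) c).toAddMonoidHom
      naturality := fun _ _ _ => rfl }

/-- The sheaf cohomology group `H¹(U, 𝒪)` of an open set `U ⊆ ℂⁿ/Λ`. -/
def H1 {n : ℕ} (Λ : AddSubgroup (Fin n → ℂ)) (U : Opens (GroupQuotient Λ)) : Type :=
  Sheaf.H' (structureSheaf Λ) 1 U

instance {n : ℕ} (Λ : AddSubgroup (Fin n → ℂ)) (U : Opens (GroupQuotient Λ)) : AddCommGroup (H1 Λ U) :=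
  inferInstanceAs (AddCommGroup (Sheaf.H' (structureSheaf Λ) 1 U))

theorem scalar_one {n : ℕ} (Λ : AddSubgroup (Fin n → ℂ)) : scalar Λ 1 = 𝟙 _ := by
  ext V f
  exact one_smul ℂ (show holomorphic Λ V.unop from f)

theorem scalar_mul {n : ℕ} (Λ : AddSubgroup (Fin n → ℂ)) (c d : ℂ) :
    scalar Λ (c * d) = scalar Λ d ≫ scalar Λ c := by
  ext V f
  exact mul_smul c d (show holomorphic Λ V.unop from f)

theorem scalar_add {n : ℕ} (Λ : AddSubgroup (Fin n → ℂ)) (c d : ℂ) :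
    scalar Λ (c + d) = scalar Λ c + scalar Λ d := by
  ext V f
  exact add_smul c d (show holomorphic Λ V.unop from f)

theorem scalar_zero {n : ℕ} (Λ : AddSubgroup (Fin n → ℂ)) : scalar Λ 0 = 0 := by
  ext V f
  exact zero_smul ℂ (show holomorphic Λ V.unop from f)

/-- The endomorphism of `H¹(U, 𝒪)` induced by an endomorphism of the sheaf `𝒪`. -/
def H1.map {n : ℕ} (Λ : AddSubgroup (Fin n → ℂ)) (U : Opens (GroupQuotient Λ))
    (φ : structureSheaf Λ ⟶ structureSheaf Λ) : H1 Λ U →+ H1 Λ U :=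
  (((Sheaf.cohomologyPresheafFunctor
    (Opens.grothendieckTopology (TopCat.of (GroupQuotient Λ))) 1).map φ).app (op U)).hom

theorem H1.map_add {n : ℕ} (Λ : AddSubgroup (Fin n → ℂ)) (U : Opens (GroupQuotient Λ))
    (φ ψ : structureSheaf Λ ⟶ structureSheaf Λ) :
    H1.map Λ U (φ + ψ) = H1.map Λ U φ + H1.map Λ U ψ := by
  ext x
  exact congrArg (fun h => h.hom x) ((Abelian.extFunctorObj _ 1).map_add (f := φ) (g := ψ))

theorem H1.map_zero {n : ℕ} (Λ : AddSubgroup (Fin n → ℂ)) (U : Opens (GroupQuotient Λ)) :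
    H1.map Λ U 0 = 0 := by
  simpa using H1.map_add Λ U 0 0

/-- The `ℂ`-vector space structure of `H¹(U, 𝒪)`: the number `c` acts by the map induced by
multiplication by `c` on the sheaf `𝒪`. -/
instance {n : ℕ} (Λ : AddSubgroup (Fin n → ℂ)) (U : Opens (GroupQuotient Λ)) :
    Module ℂ (H1 Λ U) where
  smul c x := H1.map Λ U (scalar Λ c) x
  smul_zero c := map_zero (H1.map Λ U (scalar Λ c))
  smul_add c := map_add (H1.map Λ U (scalar Λ c))
  one_smul x := by
    change H1.map Λ U (scalar Λ 1) x = x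
    rw [scalar_one, H1.map, CategoryTheory.Functor.map_id]; rfl
  mul_smul c d x := by
    change H1.map Λ U (scalar Λ (c * d)) x = H1.map Λ U (scalar Λ c) (H1.map Λ U (scalar Λ d) x)
    rw [scalar_mul, H1.map, CategoryTheory.Functor.map_comp]; rfl
  add_smul c d x := by
    change H1.map Λ U (scalar Λ (c + d)) x
      = H1.map Λ U (scalar Λ c) x + H1.map Λ U (scalar Λ d) x
    rw [scalar_add, H1.map_add]; rfl
  zero_smul x := by
    change H1.map Λ U (scalar Λ 0) x = 0
    rw [scalar_zero, H1.map_zero]; rfl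

/-- `ℂⁿ/Λ` is a Cousin group: every holomorphic function on it is constant. -/
def IsCousin {n : ℕ} (Λ : AddSubgroup (Fin n → ℂ)) : Prop :=
  ∀ f : GroupQuotient Λ → ℂ, Differentiable ℂ (f ∘ proj Λ) → ∀ x y, f x = f y

/-! ### Normal forms and dispersiveness -/

/-- The data of a normal form for a discrete subgroup of rank `n + m` in `ℂⁿ`, with `k = n - m`:
real `m × m` matrices `M`, `N` with `N` invertible, and a real `k × 2m` matrix `R = (R₁ R₂)`. -/
structure NormalForm (m k : ℕ) where
  M : Matrix (Fin m) (Fin m) ℝ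
  N : Matrix (Fin m) (Fin m) ℝ
  isUnit_det : IsUnit N.det
  R : Matrix (Fin k) (Fin m ⊕ Fin m) ℝ

/-- The block `T = (I_m  M + iN)`. -/
def NormalForm.T {m k : ℕ} (F : NormalForm m k) : Matrix (Fin m) (Fin m ⊕ Fin m) ℂ :=
  Matrix.fromCols 1 (F.M.map Complex.ofReal + Complex.I • F.N.map Complex.ofReal)

/-- The period matrix
```
  0    I_m   M + iN
 I_k   R₁     R₂
```
-/
def NormalForm.periodMatrix {m k : ℕ} (F : NormalForm m k) :
    Matrix (Fin m ⊕ Fin k) (Fin k ⊕ (Fin m ⊕ Fin m)) ℂ :=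
  Matrix.fromBlocks 0 F.T 1 (F.R.map Complex.ofReal)

/-- The subgroup generated by the columns of the period matrix. -/
def NormalForm.subgroup {m k : ℕ} (F : NormalForm m k) : AddSubgroup (Fin m ⊕ Fin k → ℂ) :=
  AddSubgroup.closure (Set.range F.periodMatrix.col)

/-- In suitable complex linear coordinates of `ℂⁿ`, the subgroup `Λ` is generated by the columns
of the period matrix of `F`. -/
def NormalForm.IsNormalFormOf {n m k : ℕ} (F : NormalForm m k) (Λ : AddSubgroup (Fin n → ℂ)) :
    Prop :=
  ∃ φ : (Fin n → ℂ) ≃ₗ[ℂ] (Fin m ⊕ Fin k → ℂ), Λ.map φ.toAddMonoidHom = F.subgroup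

/-- Strong dispersiveness:
`∀ a ∈ (0,1), ∃ C > 0, ∀ σ ∈ ℤᵏ \ {0}, ∀ τ ∈ ℤ²ᵐ, ‖ᵗσ R + ᵗτ‖ ≥ C a^|σ|`,
where `‖·‖` is the maximum norm on `ℝ²ᵐ` and `|σ| = ∑ |σᵢ|`. -/
def NormalForm.StronglyDispersive {m k : ℕ} (F : NormalForm m k) : Prop :=
  ∀ a : ℝ, 0 < a → a < 1 → ∃ C : ℝ, 0 < C ∧
    ∀ σ : Fin k → ℤ, σ ≠ 0 → ∀ τ : Fin m ⊕ Fin m → ℤ,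
      C * a ^ (∑ i, (σ i).natAbs) ≤
        ‖Matrix.vecMul (fun i => (σ i : ℝ)) F.R + fun j => (τ j : ℝ)‖

end CousinGroup

end

/-!
Suppose strong dispersiveness fails for some `a ∈ (0, 1)`. Since `ℂⁿ/Λ` is a Cousin group, no
nonzero integral row `ᵗσ` makes `ᵗσ R` integral (otherwise the character
`χ_σ(w) = exp (2πi ⟨σ, w''⟩)` of the last coordinates `w''` would be a nonconstant holomorphic
function on the quotient, `character_ne_one_of_isCousin`). Hence there is a sequence `σ_l` with
`|σ_l|` strictly increasing along which `ᵗσ_l R` is within `a^|σ_l|` of an integral row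
(`exists_isResonant`). Choose `r > 0` with `a exp(2πr) < 1` and let `U` be the image in the quotient
of the convex tube `|Im w''| < r`. The claim is that `H¹(U, 𝒪)` is infinite dimensional.

*Classes.* The series `∑ₗ |σ_l|ᵖ χ_{σ_l}` diverges, but its differences under translation by `v ∈ Λ`
are the series `∑ₗ |σ_l|ᵖ (χ_{σ_l}(v) - 1) χ_{σ_l}`, whose small divisors make them converge on the
tube to holomorphic functions. They form a cocycle of `Λ`, which has a discontinuous primitive on
`ℂⁿ` (`formalPrimitive`).

*From cocycles to sheaf cohomology.* Embed `𝒪` in the sheaf of all functions on the quotient; the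
cokernel is the sheaf of families of functions on `ℂⁿ`, taken modulo functions holomorphic near a
fibre, which locally come from functions on the quotient (`polarSequence_shortExact`). A function
on `ℂⁿ` with holomorphic translation differences over `U` is a section of this cokernel, because the
projection has local sections; the connecting homomorphism sends it to `H¹(U, 𝒪)`. So if `H¹(U, 𝒪)`
is finite dimensional, some nontrivial combination of the primitives becomes holomorphic on the
tube after adding the pull-back of a function on the quotient (`exists_combination_pullback`).

*Nontriviality.* That gives a holomorphic `h` on the tube with
`h(w + v) - h(w) = -∑ₗ Q(|σ_l|) (χ_{σ_l}(v) - 1) χ_{σ_l}(w)` for `v ∈ Λ`, where `Q` is a nonconstant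
polynomial. For fixed first coordinates `u`, the function `h` is periodic in the real last
coordinates, and its Fourier coefficient `g_l(u)` of index `σ_l` is entire in `u`. The
functional equation says that `g_l + Q(|σ_l|)` is multiplied by a constant of modulus one under
translation by the columns of `T`, so it is bounded, constant by Liouville, and zero because one of
these constants is not `1`. Thus `|Q(|σ_l|)| = |g_l(0)|` stays bounded in `l`
(`exists_bound_coefficients`), which is absurd.
-/

noncomputable section

open CategoryTheory TopologicalSpace Opposite Topology

namespace CousinGroup

/-! ### The connecting homomorphism on sections -/

/-- The abelian sheaf freely generated by the open set `U`; it represents sections over `U`. -/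
abbrev freeSheaf {X : TopCat.{0}} (U : Opens X) :
    CategoryTheory.Sheaf (Opens.grothendieckTopology X) AddCommGrpCat.{0} :=
  (yoneda ⋙ (Functor.whiskeringRight _ _ _).obj
      AddCommGrpCat.free ⋙ presheafToSheaf (Opens.grothendieckTopology X) _).obj U

/-- The tautological section of `freeSheaf U` over `U`. -/
def tautSection {X : TopCat.{0}} (U : Opens X) : (freeSheaf U).obj.obj (op U) :=
  (toSheafify (Opens.grothendieckTopology X) (yoneda.obj U ⋙ AddCommGrpCat.free)).app (op U)
    (FreeAbelianGroup.of (𝟙 U))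

/-- The free abelian sheaf on `U` represents sections over `U`: a morphism from it is determined
by its value at the tautological section, which is arbitrary. -/
theorem existsUnique_hom_freeSheaf {X : TopCat.{0}} (U : Opens X)
    (F : CategoryTheory.Sheaf (Opens.grothendieckTopology X) AddCommGrpCat.{0})
    (s : F.obj.obj (op U)) :
    ∃! α : freeSheaf U ⟶ F, α.hom.app (op U) (tautSection U) = s := by
  let e₁ := (sheafificationAdjunction (Opens.grothendieckTopology X) AddCommGrpCat.{0}).homEquiv
    (yoneda.obj U ⋙ AddCommGrpCat.free) F
  let e₂ := (AddCommGrpCat.adj.{0}.whiskerRight (Opens X)ᵒᵖ).homEquiv (yoneda.obj U) F.obj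
  let e₃ := yonedaEquiv (X := U) (F := F.obj ⋙ CategoryTheory.forget AddCommGrpCat.{0})
  have key : ∀ α : freeSheaf U ⟶ F, e₃ (e₂ (e₁ α)) = α.hom.app (op U) (tautSection U) := by
    exact fun _ => rfl
  obtain ⟨α, hα, huniq⟩ := (e₁.trans (e₂.trans e₃)).bijective.existsUnique s
  exact ⟨α, (key α).symm.trans hα, fun β hβ => huniq β ((key β).trans hβ)⟩

/-- The connecting homomorphism `S.X₃(U) → H¹(U, S.X₁)` of a short exact sequence of abelian
sheaves: its kernel consists of the sections that lift to `S.X₂(U)`, and it is natural for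
endomorphisms of the sequence. -/
theorem exists_connecting {X : TopCat.{0}} (U : Opens X)
    {S : ShortComplex (CategoryTheory.Sheaf (Opens.grothendieckTopology X) AddCommGrpCat.{0})}
    (hS : S.ShortExact) :
    ∃ δ : S.X₃.obj.obj (op U) →+ CategoryTheory.Sheaf.H' S.X₁ 1 U,
      (∀ s, δ s = 0 → ∃ t, S.g.hom.app (op U) t = s) ∧
      ∀ (φ : S ⟶ S) (s : S.X₃.obj.obj (op U)),
        δ (φ.τ₃.hom.app (op U) s) =
          (((CategoryTheory.Sheaf.cohomologyPresheafFunctor (Opens.grothendieckTopology X) 1).map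
            φ.τ₁).app (op U)).hom (δ s) := by
  choose r hr hr' using fun s => existsUnique_hom_freeSheaf U S.X₃ s
  have radd : ∀ s t, r (s + t) = r s + r t := fun s t => by
    refine (hr' (s + t) (r s + r t) ?_).symm
    change (r s).hom.app (op U) (tautSection U) + (r t).hom.app (op U) (tautSection U) = s + t
    rw [hr, hr]
  let δ : S.X₃.obj.obj (op U) →+ CategoryTheory.Sheaf.H' S.X₁ 1 U :=
    AddMonoidHom.mk' (fun s => (Abelian.Ext.mk₀ (r s)).comp hS.extClass (zero_add 1))
      (fun s t => by rw [radd, Abelian.Ext.mk₀_add, Abelian.Ext.add_comp]; rfl)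
  refine ⟨δ, fun s hs => ?_, fun φ s => ?_⟩
  · obtain ⟨x, hx⟩ := Abelian.Ext.covariant_sequence_exact₃ (freeSheaf U) hS
      (Abelian.Ext.mk₀ (r s)) (zero_add 1) hs
    obtain ⟨β, rfl⟩ := (Abelian.Ext.mk₀_bijective _ _).2 x
    rw [Abelian.Ext.mk₀_comp_mk₀] at hx
    refine ⟨β.hom.app (op U) (tautSection U), ?_⟩
    rw [← hr s, ← (Abelian.Ext.mk₀_bijective _ _).1 hx]
    rfl
  · have h : r (φ.τ₃.hom.app (op U) s) = r s ≫ φ.τ₃ := by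
      refine (hr' _ _ ?_).symm
      change φ.τ₃.hom.app (op U) ((r s).hom.app (op U) (tautSection U)) = _
      rw [hr]
    change (Abelian.Ext.mk₀ (r _)).comp hS.extClass (zero_add 1) =
      ((Abelian.Ext.mk₀ (r s)).comp hS.extClass (zero_add 1)).comp
        (Abelian.Ext.mk₀ φ.τ₁) (add_zero 1)
    rw [h, ← Abelian.Ext.mk₀_comp_mk₀, Abelian.Ext.comp_assoc_of_second_deg_zero,
      Abelian.Ext.comp_assoc_of_third_deg_zero, hS.extClass_naturality hS φ]

/-! ### Functions modulo holomorphic functions -/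

section
variable {n : ℕ} (Λ : AddSubgroup (Fin n → ℂ))

/-- The functions on `ℂⁿ` that are complex differentiable in a neighbourhood of each point of the
fibre over `x`. -/
def holGerm (x : GroupQuotient Λ) : Submodule ℂ ((Fin n → ℂ) → ℂ) where
  carrier := {g | ∀ z, proj Λ z = x → ∀ᶠ w in 𝓝 z, DifferentiableAt ℂ g w}
  add_mem' hf hg z hz := ((hf z hz).and (hg z hz)).mono fun _ h => h.1.add h.2
  zero_mem' _ _ := Filter.Eventually.of_forall fun _ => differentiableAt_const (0 : ℂ)
  smul_mem' c _ hf z hz := (hf z hz).mono fun _ h => h.const_smul c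

/-- Functions on `ℂⁿ` modulo functions holomorphic near the fibre over `x`. Only the germ along the
fibre matters, so global functions can be used as representatives. -/
abbrev PolarPart (x : GroupQuotient Λ) : Type := ((Fin n → ℂ) → ℂ) ⧸ holGerm Λ x

/-- The class at `x` of the pull-back to `ℂⁿ` of a function on `ℂⁿ/Λ`. -/
def polar (x : GroupQuotient Λ) : (GroupQuotient Λ → ℂ) →ₗ[ℂ] PolarPart Λ x :=
  (holGerm Λ x).mkQ ∘ₗ LinearMap.funLeft ℂ ℂ (proj Λ)

/-- The families of classes that locally come from a single function on `ℂⁿ/Λ`. -/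
def polarLocal : TopCat.LocalPredicate (X := TopCat.of (GroupQuotient Λ)) (PolarPart Λ) :=
  TopCat.PrelocalPredicate.sheafify
    { pred := fun {V} q => ∃ f : GroupQuotient Λ → ℂ, ∀ x : V, q x = polar Λ x f
      res := fun i _ ⟨f, hf⟩ => ⟨f, fun x => hf ⟨x.1, i.le x.2⟩⟩ }

/-- The `ℂ`-vector space of families of classes over `V` that locally come from a function. -/
def polarSections (V : Opens (GroupQuotient Λ)) : Submodule ℂ (∀ x : V, PolarPart Λ x) where
  carrier := {q | (polarLocal Λ).pred (U := V) q}
  add_mem' {a b} ha hb x := by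
    obtain ⟨W, hW, i, f, hf⟩ := ha x
    obtain ⟨W', hW', i', f', hf'⟩ := hb x
    refine ⟨W ⊓ W', ⟨hW, hW'⟩, Opens.infLELeft _ _ ≫ i, f + f', fun y => ?_⟩
    rw [map_add]
    exact congrArg₂ (· + ·) (hf ⟨y.1, y.2.1⟩) (hf' ⟨y.1, y.2.2⟩)
  zero_mem' x := ⟨V, x.2, 𝟙 _, 0, fun y => by rw [map_zero]; rfl⟩
  smul_mem' c a ha x := by
    obtain ⟨W, hW, i, f, hf⟩ := ha x
    refine ⟨W, hW, i, c • f, fun y => ?_⟩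
    rw [map_smul]
    exact congrArg (c • ·) (hf y)

/-- Restriction of polar sections to a smaller open set. -/
def polarRestrict {V W : Opens (GroupQuotient Λ)} (h : W ≤ V) :
    polarSections Λ V →ₗ[ℂ] polarSections Λ W where
  toFun f := ⟨fun x => f.1 ⟨x.1, h x.2⟩,
    (polarLocal Λ).res (U := W) (V := V) (homOfLE h) f.1 f.2⟩
  map_add' _ _ := rfl
  map_smul' _ _ := rfl

/-- The sheaf `V ↦ polarSections Λ V`: the quotient of the sheaf of all functions on `ℂⁿ/Λ` by the
structure sheaf. -/
def polarSheaf :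
    Sheaf (Opens.grothendieckTopology (TopCat.of (GroupQuotient Λ))) AddCommGrpCat.{0} where
  obj :=
    { obj V := AddCommGrpCat.of (polarSections Λ V.unop)
      map i := AddCommGrpCat.ofHom (polarRestrict Λ (leOfHom i.unop)).toAddMonoidHom
      map_id _ := rfl
      map_comp _ _ := rfl }
  property := by
    rw [CategoryTheory.Presheaf.isSheaf_iff_isSheaf_forget _ _
      (CategoryTheory.forget AddCommGrpCat)]
    exact (TopCat.subsheafToTypes (polarLocal Λ)).property

/-- The sheaf of all complex functions on `ℂⁿ/Λ`, without any continuity condition. -/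
def functionSheaf :
    Sheaf (Opens.grothendieckTopology (TopCat.of (GroupQuotient Λ))) AddCommGrpCat.{0} where
  obj :=
    { obj V := AddCommGrpCat.of (V.unop → ℂ)
      map i := AddCommGrpCat.ofHom
        (LinearMap.funLeft ℂ ℂ (fun x => ⟨x.1, leOfHom i.unop x.2⟩)).toAddMonoidHom
      map_id _ := rfl
      map_comp _ _ := rfl }
  property := by
    rw [CategoryTheory.Presheaf.isSheaf_iff_isSheaf_forget _ _
      (CategoryTheory.forget AddCommGrpCat)]
    exact (TopCat.sheafToType (TopCat.of (GroupQuotient Λ)) ℂ).property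

theorem polar_eq_iff {x : GroupQuotient Λ} {f g : GroupQuotient Λ → ℂ} :
    polar Λ x f = polar Λ x g ↔ ∀ z, proj Λ z = x →
      ∀ᶠ w in 𝓝 z, DifferentiableAt ℂ (fun w => f (proj Λ w) - g (proj Λ w)) w :=
  Submodule.Quotient.eq _

theorem polar_congr {x : GroupQuotient Λ} {f g : GroupQuotient Λ → ℂ} (h : f =ᶠ[𝓝 x] g) :
    polar Λ x f = polar Λ x g := by
  refine (polar_eq_iff Λ).2 fun z hz => ?_
  subst hz
  filter_upwards [((continuous_proj Λ).continuousAt.eventually h).eventually_nhds] with w hw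
  refine (differentiableAt_const (0 : ℂ)).congr_of_eventuallyEq (hw.mono fun v hv => ?_)
  exact sub_eq_zero.2 hv

/-- The classes of a function on `V`, extended by zero to the whole quotient. -/
def toPolar (V : Opens (GroupQuotient Λ)) : (V → ℂ) →ₗ[ℂ] polarSections Λ V where
  toFun f := ⟨fun x => polar Λ x (Function.extend Subtype.val f 0),
    fun x => ⟨V, x.2, 𝟙 _, Function.extend Subtype.val f 0, fun _ => rfl⟩⟩
  map_add' f g := by
    ext1; funext x
    change polar Λ x _ = polar Λ x _ + polar Λ x _
    rw [← map_add, ← Function.extend_add, add_zero]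
  map_smul' c f := by
    ext1; funext x
    change polar Λ x _ = c • polar Λ x _
    rw [← map_smul, ← Function.extend_smul, smul_zero]

theorem extend_eventuallyEq {V W : Opens (GroupQuotient Λ)} (h : W ≤ V) (f : V → ℂ)
    {x : GroupQuotient Λ} (hx : x ∈ W) :
    Function.extend Subtype.val f 0 =ᶠ[𝓝 x]
      Function.extend Subtype.val (fun y : W => f ⟨y.1, h y.2⟩) 0 := by
  filter_upwards [W.isOpen.mem_nhds hx] with y hy
  exact (Subtype.val_injective.extend_apply f 0 ⟨y, h hy⟩).trans
    (Subtype.val_injective.extend_apply (fun y : W => f ⟨y.1, h y.2⟩) 0 ⟨y, hy⟩).symm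

theorem toPolar_restrict {V W : Opens (GroupQuotient Λ)} (h : W ≤ V) (f : V → ℂ) :
    polarRestrict Λ h (toPolar Λ V f) = toPolar Λ W (fun x => f ⟨x.1, h x.2⟩) :=
  Subtype.ext (funext fun x => polar_congr Λ (extend_eventuallyEq Λ h f x.2))

/-- The inclusion of the structure sheaf in the sheaf of all functions. -/
def inclusion : structureSheaf Λ ⟶ functionSheaf Λ :=
  CategoryTheory.ObjectProperty.homMk
    { app := fun V => AddCommGrpCat.ofHom (holomorphic Λ V.unop).subtype.toAddMonoidHom
      naturality := fun _ _ _ => rfl }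

/-- The quotient map from the sheaf of all functions, given on sections by `toPolar`. -/
def polarMap : functionSheaf Λ ⟶ polarSheaf Λ :=
  CategoryTheory.ObjectProperty.homMk
    { app := fun V => AddCommGrpCat.ofHom (toPolar Λ V.unop).toAddMonoidHom
      naturality := fun V W i => by
        ext f
        exact (toPolar_restrict Λ (leOfHom i.unop) f).symm }

/-- Multiplication by `c` on the sheaf of all functions. -/
def functionScalar (c : ℂ) : functionSheaf Λ ⟶ functionSheaf Λ :=
  CategoryTheory.ObjectProperty.homMk
    { app := fun V => AddCommGrpCat.ofHom
        (LinearMap.lsmul ℂ (V.unop → ℂ) c).toAddMonoidHom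
      naturality := fun _ _ _ => rfl }

/-- Multiplication by `c` on the sheaf of polar sections. -/
def polarScalar (c : ℂ) : polarSheaf Λ ⟶ polarSheaf Λ :=
  CategoryTheory.ObjectProperty.homMk
    { app := fun V => AddCommGrpCat.ofHom
        (LinearMap.lsmul ℂ (polarSections Λ V.unop) c).toAddMonoidHom
      naturality := fun _ _ _ => rfl }

theorem toPolar_eq_zero_iff {V : Opens (GroupQuotient Λ)} (f : V → ℂ) :
    toPolar Λ V f = 0 ↔ IsHolomorphic Λ f := by
  have hopen : IsOpen (proj Λ ⁻¹' (V : Set (GroupQuotient Λ))) :=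
    V.isOpen.preimage (continuous_proj Λ)
  have h : toPolar Λ V f = 0 ↔ ∀ x : V, ∀ z, proj Λ z = x →
      ∀ᶠ w in 𝓝 z, DifferentiableAt ℂ (lift Λ f) w := by
    rw [Subtype.ext_iff, funext_iff]
    exact forall_congr' fun x => Submodule.Quotient.mk_eq_zero _
  rw [h]
  constructor
  · intro h z hz
    exact (h ⟨_, hz⟩ z rfl).self_of_nhds.differentiableWithinAt
  · intro h x z hz
    have hzV : z ∈ proj Λ ⁻¹' (V : Set (GroupQuotient Λ)) := by
      rw [Set.mem_preimage, hz]; exact x.2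
    filter_upwards [hopen.mem_nhds hzV] with w hw
    exact (h w hw).differentiableAt (hopen.mem_nhds hw)

/-- The sequence `0 → 𝒪 → (all functions) → (polar sections) → 0`. -/
def polarSequence : ShortComplex
    (CategoryTheory.Sheaf (Opens.grothendieckTopology (TopCat.of (GroupQuotient Λ)))
      AddCommGrpCat.{0}) where
  X₁ := structureSheaf Λ
  X₂ := functionSheaf Λ
  X₃ := polarSheaf Λ
  f := inclusion Λ
  g := polarMap Λ
  zero := by
    ext V f
    exact (toPolar_eq_zero_iff Λ _).2 (show holomorphic Λ V.unop from f).2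

/-- Multiplication by `c` on the whole sequence; through naturality it makes the connecting
homomorphism `ℂ`-linear. -/
def sequenceScalar (c : ℂ) : polarSequence Λ ⟶ polarSequence Λ where
  τ₁ := scalar Λ c
  τ₂ := functionScalar Λ c
  τ₃ := polarScalar Λ c
  comm₁₂ := rfl
  comm₂₃ := by
    ext V f
    exact map_smul (toPolar Λ V.unop) c (show V.unop → ℂ from f)

theorem polarSequence_shortExact : (polarSequence Λ).ShortExact where
  exact := by
    refine ShortComplex.exact_of_f_is_kernel _ (Limits.KernelFork.IsLimit.ofι _ _
      (fun {A} k hk => CategoryTheory.ObjectProperty.homMk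
        { app := fun V => AddCommGrpCat.ofHom
            { toFun := fun a => ⟨k.hom.app V a, (toPolar_eq_zero_iff Λ _).1
                (ConcreteCategory.congr_hom (congrArg (fun t => t.hom.app V) hk) a)⟩
              map_zero' := Subtype.ext (map_zero (k.hom.app V).hom)
              map_add' := fun a b => Subtype.ext (map_add (k.hom.app V).hom a b) }
          naturality := fun V W i => by
            ext a
            exact Subtype.ext (ConcreteCategory.congr_hom (k.hom.naturality i) a) })
      (fun {A} k hk => rfl) (fun {A} k hk b hb => ?_))
    ext V a
    exact Subtype.ext (ConcreteCategory.congr_hom (congrArg (fun t => t.hom.app V) hb) a)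
  mono_f := CategoryTheory.Sheaf.mono_of_injective _ fun V f g h => Subtype.ext h
  epi_g := by
    have : CategoryTheory.Sheaf.IsLocallySurjective (polarMap Λ) := by
      refine (TopCat.Presheaf.isLocallySurjective_iff (polarMap Λ).hom).2 fun V q x hx => ?_
      obtain ⟨W, hW, i, f, hf⟩ := (show polarSections Λ V from q).2 ⟨x, hx⟩
      refine ⟨W, i.le, ⟨fun y : W => f y.1, Subtype.ext (funext fun y => ?_)⟩, hW⟩
      refine (polar_congr Λ ?_).trans (hf y).symm
      filter_upwards [W.isOpen.mem_nhds y.2] with v hv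
      exact Subtype.val_injective.extend_apply (fun y : W => f y.1) 0 ⟨v, hv⟩
    exact CategoryTheory.Sheaf.epi_of_isLocallySurjective (polarMap Λ)

end

section
variable {n : ℕ} (Λ : AddSubgroup (Fin n → ℂ))

/-! ### Functions with holomorphic translation differences -/

/-- Functions on `ℂⁿ` whose differences under translation by `Λ` are holomorphic above `U`; the
functions themselves are arbitrary. -/
def quasiperiodic (U : Opens (GroupQuotient Λ)) : Submodule ℂ ((Fin n → ℂ) → ℂ) where
  carrier := {Φ | ∀ v ∈ Λ, ∀ z, proj Λ z ∈ U → DifferentiableAt ℂ (fun w => Φ (w + v) - Φ w) z}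
  add_mem' {a b} ha hb v hv z hz := by
    refine ((ha v hv z hz).add (hb v hv z hz)).congr_of_eventuallyEq (.of_forall fun w => ?_)
    simp only [Pi.add_apply]; ring
  zero_mem' v _ z _ := by simp
  smul_mem' c a ha v hv z hz := by
    refine ((ha v hv z hz).const_smul c).congr_of_eventuallyEq (.of_forall fun w => ?_)
    simp only [Pi.smul_apply, smul_eq_mul]; ring

theorem proj_add {v : Fin n → ℂ} (hv : v ∈ Λ) (z : Fin n → ℂ) : proj Λ (z + v) = proj Λ z :=
  (QuotientAddGroup.mk_add_of_mem z hv)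

theorem sub_mem_of_proj_eq {z w : Fin n → ℂ} (h : proj Λ z = proj Λ w) : w - z ∈ Λ := by
  rw [sub_eq_neg_add]
  exact QuotientAddGroup.eq.1 h

theorem isOpenMap_proj : IsOpenMap (proj Λ) := QuotientAddGroup.isOpenMap_coe

/-- A function with holomorphic translation differences defines a polar section: near a point of
the quotient it differs by a holomorphic function from the pull-back of its restriction to one
sheet of the projection. -/
theorem quasiperiodic_locally_polar (hΛ : ∃ ε > 0, ∀ v ∈ Λ, ‖v‖ < ε → v = 0)
    {U : Opens (GroupQuotient Λ)} {Φ : (Fin n → ℂ) → ℂ} (hΦ : Φ ∈ quasiperiodic Λ U) :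
    (fun x : U => (holGerm Λ x.1).mkQ Φ) ∈ polarSections Λ U := by
  rintro ⟨x, hx⟩
  obtain ⟨z₀, rfl⟩ := QuotientAddGroup.mk_surjective x
  obtain ⟨ε, hε, hΛ⟩ := hΛ
  set B := Metric.ball z₀ (ε / 2) with hB
  have hinj : ∀ w ∈ B, ∀ w' ∈ B, proj Λ w = proj Λ w' → w = w' := by
    intro w hw w' hw' h
    refine (sub_eq_zero.1 (hΛ _ (sub_mem_of_proj_eq Λ h) ?_)).symm
    rw [← dist_eq_norm]
    calc dist w' w ≤ dist w' z₀ + dist w z₀ := dist_triangle_right _ _ _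
      _ < ε := by linarith [Metric.mem_ball.1 hw, Metric.mem_ball.1 hw']
  classical
  -- transport `Φ` to the quotient through the sheet `B`, on which the projection is injective
  let f : GroupQuotient Λ → ℂ := fun y => if h : ∃ w ∈ B, proj Λ w = y then Φ h.choose else 0
  have hf : ∀ w ∈ B, f (proj Λ w) = Φ w := by
    intro w hw
    have h : ∃ w' ∈ B, proj Λ w' = proj Λ w := ⟨w, hw, rfl⟩
    have h' := h.choose_spec
    change (if h : ∃ w' ∈ B, proj Λ w' = proj Λ w then Φ h.choose else 0) = _
    rw [dif_pos h, hinj _ h'.1 _ hw h'.2]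
  let V : Opens (GroupQuotient Λ) := ⟨proj Λ '' B, isOpenMap_proj Λ _ Metric.isOpen_ball⟩
  refine ⟨U ⊓ V, ⟨hx, z₀, Metric.mem_ball_self (half_pos hε), rfl⟩, Opens.infLELeft _ _, f, ?_⟩
  rintro ⟨y, hyU, w, hw, rfl⟩
  refine (Submodule.Quotient.eq _).2 fun z hz => ?_
  have hv := sub_mem_of_proj_eq Λ hz
  set v := w - z with hv'
  have hzU : proj Λ z ∈ U := hz ▸ hyU
  have hUo : IsOpen (proj Λ ⁻¹' (U : Set (GroupQuotient Λ))) :=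
    U.isOpen.preimage (continuous_proj Λ)
  have hBo : ∀ᶠ u in 𝓝 z, u + v ∈ B := by
    refine (continuous_id.add continuous_const).continuousAt.eventually_mem
      (Metric.isOpen_ball.mem_nhds ?_)
    change z + v ∈ B
    rwa [hv', add_sub_cancel]
  filter_upwards [hBo.eventually_nhds, hUo.mem_nhds hzU] with u hu huU
  refine ((hΦ v hv u huU).neg).congr_of_eventuallyEq ?_
  filter_upwards [hu] with t ht
  have := hf _ ht
  rw [proj_add Λ hv] at this
  simp [LinearMap.funLeft, this]

/-- The polar section defined by a function with holomorphic translation differences. -/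
def quasiperiodicToPolar (hΛ : ∃ ε > 0, ∀ v ∈ Λ, ‖v‖ < ε → v = 0)
    (U : Opens (GroupQuotient Λ)) : quasiperiodic Λ U →ₗ[ℂ] polarSections Λ U where
  toFun Φ := ⟨fun x => (holGerm Λ x.1).mkQ Φ.1, quasiperiodic_locally_polar Λ hΛ Φ.2⟩
  map_add' _ _ := rfl
  map_smul' _ _ := rfl

theorem exists_linear_connecting (U : Opens (GroupQuotient Λ)) :
    ∃ δ : polarSections Λ U →ₗ[ℂ] H1 Λ U, ∀ s, δ s = 0 → ∃ f, toPolar Λ U f = s := by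
  obtain ⟨δ, h, h'⟩ := exists_connecting U (polarSequence_shortExact Λ)
  exact ⟨{ toFun := δ, map_add' := map_add δ,
           map_smul' := fun c s => h' (sequenceScalar Λ c) s }, h⟩

/-- If `H¹(U, 𝒪)` is finite dimensional, then among countably many functions with holomorphic
translation differences some nontrivial combination is, above `U`, holomorphic up to the pull-back
of a function on the quotient. -/
theorem exists_combination_pullback (hΛ : ∃ ε > 0, ∀ v ∈ Λ, ‖v‖ < ε → v = 0)
    (U : Opens (GroupQuotient Λ)) [FiniteDimensional ℂ (H1 Λ U)]
    {Φ : ℕ → (Fin n → ℂ) → ℂ} (hΦ : ∀ p, Φ p ∈ quasiperiodic Λ U) :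
    ∃ c : ℕ →₀ ℂ, c ≠ 0 ∧ ∃ f : GroupQuotient Λ → ℂ, ∀ z, proj Λ z ∈ U →
      DifferentiableAt ℂ (fun w => f (proj Λ w) - c.sum fun p a => a * Φ p w) z := by
  obtain ⟨δ, hδ⟩ := exists_linear_connecting Λ U
  let T := quasiperiodicToPolar Λ hΛ U
  let q : ℕ → quasiperiodic Λ U := fun p => ⟨Φ p, hΦ p⟩
  have hdep : ¬ LinearIndependent ℂ (fun p => δ (T (q p))) := fun h =>
    not_finite_iff_infinite.2 (inferInstanceAs (Infinite ℕ)) h.finite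
  rw [linearIndependent_iff] at hdep
  push Not at hdep
  obtain ⟨c, hc, hc0⟩ := hdep
  refine ⟨c, hc0, ?_⟩
  have hc' : δ (T (c.sum fun p a => a • q p)) = 0 := by
    rw [← hc, Finsupp.linearCombination_apply, map_finsuppSum, map_finsuppSum]
    simp
  obtain ⟨f, hf⟩ := hδ _ hc'
  refine ⟨Function.extend Subtype.val f 0, fun z hz => ?_⟩
  have h1 := congrFun (congrArg Subtype.val hf) ⟨_, hz⟩
  have h2 := ((Submodule.Quotient.eq _).1 h1 z rfl).self_of_nhds
  refine h2.congr_of_eventuallyEq (Filter.Eventually.of_forall fun w => ?_)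
  simp [LinearMap.funLeft, Finsupp.sum, q]

end

section
variable {m k : ℕ}

/-! ### Characters of the last coordinates -/

/-- The character `w ↦ exp (2πi ⟨σ, w''⟩)`, where `w''` is the vector of the last `k`
coordinates. -/
def character (σ : Fin k → ℤ) (w : Fin m ⊕ Fin k → ℂ) : ℂ :=
  Complex.exp (2 * Real.pi * Complex.I * ∑ i, (σ i : ℂ) * w (Sum.inr i))

theorem character_add (σ : Fin k → ℤ) (v w : Fin m ⊕ Fin k → ℂ) :
    character σ (v + w) = character σ v * character σ w := by
  simp only [character, ← Complex.exp_add, Pi.add_apply, mul_add, Finset.sum_add_distrib]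

theorem character_zero (σ : Fin k → ℤ) : character σ (0 : Fin m ⊕ Fin k → ℂ) = 1 := by
  simp [character]

theorem norm_character (σ : Fin k → ℤ) (w : Fin m ⊕ Fin k → ℂ) :
    ‖character σ w‖ = Real.exp (-(2 * Real.pi * ∑ i, (σ i : ℝ) * (w (Sum.inr i)).im)) := by
  have : (∑ i, (σ i : ℂ) * w (Sum.inr i)).im = ∑ i, (σ i : ℝ) * (w (Sum.inr i)).im := by
    simp [Complex.im_sum]
  rw [character, Complex.norm_exp, ← this]
  simp

theorem norm_character_le (σ : Fin k → ℤ) {r : ℝ} {w : Fin m ⊕ Fin k → ℂ}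
    (hw : ∀ i, |(w (Sum.inr i)).im| ≤ r) :
    ‖character σ w‖ ≤ Real.exp (2 * Real.pi * r) ^ (∑ i, (σ i).natAbs) := by
  rw [norm_character, ← Real.exp_nat_mul, Real.exp_le_exp]
  have h : -(∑ i, (σ i : ℝ) * (w (Sum.inr i)).im) ≤ (∑ i, (σ i).natAbs : ℕ) * r := by
    rw [← Finset.sum_neg_distrib]
    push_cast
    rw [Finset.sum_mul]
    refine Finset.sum_le_sum fun i _ => (neg_le_abs _).trans ?_
    rw [abs_mul, Nat.cast_natAbs, Int.cast_abs]
    exact mul_le_mul_of_nonneg_left (hw i) (abs_nonneg _)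
  nlinarith [Real.pi_pos]

/-- The linear form `w ↦ ⟨σ, w''⟩`. -/
def characterForm (m : ℕ) (σ : Fin k → ℤ) : (Fin m ⊕ Fin k → ℂ) →L[ℂ] ℂ :=
  ∑ i, (σ i : ℂ) • ContinuousLinearMap.proj (Sum.inr i)

theorem norm_characterForm_le (σ : Fin k → ℤ) :
    ‖characterForm m σ‖ ≤ (∑ i, (σ i).natAbs : ℕ) := by
  refine ContinuousLinearMap.opNorm_le_bound _ (Nat.cast_nonneg _) fun w => ?_
  push_cast
  rw [characterForm, _root_.sum_apply, Finset.sum_mul]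
  refine (norm_sum_le _ _).trans (Finset.sum_le_sum fun i _ => ?_)
  simp only [_root_.smul_apply, ContinuousLinearMap.proj_apply, norm_smul]
  rw [Nat.cast_natAbs, Complex.norm_intCast, Int.cast_abs]
  exact mul_le_mul_of_nonneg_left (norm_le_pi_norm w _) (abs_nonneg _)

theorem hasFDerivAt_character (σ : Fin k → ℤ) (w : Fin m ⊕ Fin k → ℂ) :
    HasFDerivAt (character σ)
      (character σ w • ((2 * Real.pi * Complex.I) • characterForm m σ)) w := by
  have h :=
    (((characterForm m σ).hasFDerivAt (x := w)).const_smul (2 * Real.pi * Complex.I : ℂ)).cexp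
  have h2 : (fun w => Complex.exp ((2 * Real.pi * Complex.I : ℂ) • characterForm m σ w))
      = character σ := by
    funext w
    simp [character, characterForm]
  have h3 := congrFun h2 w
  change HasFDerivAt
    (fun w => Complex.exp ((2 * Real.pi * Complex.I : ℂ) • characterForm m σ w)) _ w at h
  rw [h2] at h
  convert! h using 2
  exact h3.symm

/-- The tube of points whose last coordinates have imaginary parts less than `r` in modulus. -/
def tube (m k : ℕ) (r : ℝ) : Set (Fin m ⊕ Fin k → ℂ) := {w | ∀ i, |(w (Sum.inr i)).im| < r}

theorem isOpen_tube (r : ℝ) : IsOpen (tube m k r) := by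
  simp only [tube, Set.ofPred_forall]
  exact isOpen_iInter_of_finite fun i => isOpen_lt (by fun_prop) continuous_const

theorem convex_tube (r : ℝ) : Convex ℝ (tube m k r) := by
  intro x hx y hy a b ha hb hab i
  have h1 := abs_lt.1 (hx i)
  have h2 := abs_lt.1 (hy i)
  have : ((a • x + b • y) (Sum.inr i)).im = a * (x (Sum.inr i)).im + b * (y (Sum.inr i)).im := by
    simp
  rw [this]
  exact abs_lt.2 (convex_Ioo (-r) r h1 h2 ha hb hab)

theorem zero_mem_tube {r : ℝ} (hr : 0 < r) : (0 : Fin m ⊕ Fin k → ℂ) ∈ tube m k r := fun i => by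
  simpa using hr

theorem differentiableAt_tsum_character {r : ℝ} (hr : 0 < r) {σ : ℕ → Fin k → ℤ} {d : ℕ → ℂ}
    (hd : Summable fun l => ‖d l‖ * (∑ i, (σ l i).natAbs : ℕ) *
      Real.exp (2 * Real.pi * r) ^ (∑ i, (σ l i).natAbs))
    (hd0 : Summable d)
    {w : Fin m ⊕ Fin k → ℂ} (hw : w ∈ tube m k r) :
    DifferentiableAt ℂ (fun w => ∑' l, d l * character (σ l) w) w := by
  refine (hasFDerivAt_tsum_of_isPreconnected (hd.mul_left (2 * Real.pi)) (isOpen_tube r)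
    (convex_tube r).isPreconnected
    (fun l x _ => (hasFDerivAt_character (σ l) x).const_smul (d l)) (fun l x hx => ?_)
    (x₀ := 0) (zero_mem_tube hr) (by simpa [character_zero] using hd0) hw).differentiableAt
  have h1 := norm_character_le (σ l) fun i => (hx i).le
  have h2 := norm_characterForm_le (m := m) (σ l)
  rw [norm_smul, norm_smul, norm_smul]
  have h3 : ‖(2 * Real.pi * Complex.I : ℂ)‖ = 2 * Real.pi := by
    simp [abs_of_pos Real.pi_pos]
  rw [h3]
  calc _ ≤ ‖d l‖ * (Real.exp (2 * Real.pi * r) ^ (∑ i, (σ l i).natAbs) * (2 * Real.pi *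
        (∑ i, (σ l i).natAbs : ℕ))) := by
        gcongr
    _ = _ := by ring

namespace NormalForm
variable (F : NormalForm m k)

/-! ### The period subgroup of a normal form -/

theorem im_eq_zero_of_mem {v : Fin m ⊕ Fin k → ℂ} (hv : v ∈ F.subgroup) (i : Fin k) :
    (v (Sum.inr i)).im = 0 := by
  induction hv using AddSubgroup.closure_induction with
  | mem v hv =>
    obtain ⟨j | j, rfl⟩ := hv
    · simp [periodMatrix, Matrix.one_apply, apply_ite Complex.im]
    · simp [periodMatrix]
  | zero => rfl
  | add v w _ _ hv hw => simp [hv, hw]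
  | neg v _ hv => simp [hv]

theorem add_mem_tube_iff {v : Fin m ⊕ Fin k → ℂ} (hv : v ∈ F.subgroup) {r : ℝ}
    {w : Fin m ⊕ Fin k → ℂ} : w + v ∈ tube m k r ↔ w ∈ tube m k r := by
  simp [tube, F.im_eq_zero_of_mem hv]

theorem norm_character_of_mem (σ : Fin k → ℤ) {v : Fin m ⊕ Fin k → ℂ} (hv : v ∈ F.subgroup) :
    ‖character σ v‖ = 1 := by
  simp [norm_character, F.im_eq_zero_of_mem hv]

theorem character_col_inl (σ : Fin k → ℤ) (i : Fin k) :
    character σ (F.periodMatrix.col (Sum.inl i)) = 1 := by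
  have : ∑ i', (σ i' : ℂ) * F.periodMatrix.col (Sum.inl i) (Sum.inr i') = σ i := by
    simp [periodMatrix, Matrix.one_apply]
  rw [character, this, mul_comm]
  exact Complex.exp_int_mul_two_pi_mul_I (σ i)

theorem character_col_inr (σ : Fin k → ℤ) (j : Fin m ⊕ Fin m) :
    character σ (F.periodMatrix.col (Sum.inr j)) =
      Complex.exp (2 * Real.pi * Complex.I * (Matrix.vecMul (fun i => (σ i : ℝ)) F.R j : ℝ)) := by
  simp [periodMatrix, character, Matrix.vecMul, dotProduct]

/-- The character takes at the column of index `j` the value `exp (2πi x)`, with `x` the `j`-th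
entry of `ᵗσ R`, which may be shifted by the integer `τ j`. -/
theorem norm_character_col_inr_sub_one_le (σ : Fin k → ℤ) (τ : Fin m ⊕ Fin m → ℤ)
    (j : Fin m ⊕ Fin m) :
    ‖character σ (F.periodMatrix.col (Sum.inr j)) - 1‖ ≤
      2 * Real.pi * ‖Matrix.vecMul (fun i => (σ i : ℝ)) F.R + fun j => (τ j : ℝ)‖ := by
  set x := Matrix.vecMul (fun i => (σ i : ℝ)) F.R + fun j => (τ j : ℝ) with hx
  have h1 : character σ (F.periodMatrix.col (Sum.inr j)) =
      Complex.exp (Complex.I * (2 * Real.pi * x j : ℝ)) := by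
    rw [character_col_inr]
    have h2 : Complex.I * (2 * Real.pi * x j : ℝ) =
        2 * Real.pi * Complex.I * (Matrix.vecMul (fun i => (σ i : ℝ)) F.R j : ℝ) +
          (τ j : ℤ) * (2 * Real.pi * Complex.I) := by
      simp only [hx, Pi.add_apply]; push_cast; ring
    rw [h2, Complex.exp_add, Complex.exp_int_mul_two_pi_mul_I, mul_one]
  rw [h1]
  refine (Real.norm_exp_I_mul_ofReal_sub_one_le).trans ?_
  rw [norm_mul, Real.norm_of_nonneg (by positivity)]
  exact mul_le_mul_of_nonneg_left (norm_le_pi_norm x j) (by positivity)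

/-- Approximations of the rows `ᵗσ_l R` by integral rows make the characters `χ_{σ_l}` close to `1`
at every point of the subgroup, with the same rate. -/
theorem exists_norm_character_sub_one_le {ι : Type*} {σ : ι → Fin k → ℤ} {ε : ι → ℝ}
    (hε : ∀ l, ∃ τ : Fin m ⊕ Fin m → ℤ,
      ‖Matrix.vecMul (fun i => (σ l i : ℝ)) F.R + fun j => (τ j : ℝ)‖ ≤ ε l)
    {v : Fin m ⊕ Fin k → ℂ} (hv : v ∈ F.subgroup) :
    ∃ C : ℝ, ∀ l, ‖character (σ l) v - 1‖ ≤ C * ε l := by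
  induction hv using AddSubgroup.closure_induction with
  | mem v hv =>
    obtain ⟨i | j, rfl⟩ := hv
    · exact ⟨0, fun l => by simp [character_col_inl]⟩
    · refine ⟨2 * Real.pi, fun l => ?_⟩
      obtain ⟨τ, hτ⟩ := hε l
      exact (F.norm_character_col_inr_sub_one_le (σ l) τ j).trans
        (mul_le_mul_of_nonneg_left hτ (by positivity))
  | zero => exact ⟨0, fun l => by simp [character_zero]⟩
  | add v w hvm hwm hv hw =>
    obtain ⟨C, hC⟩ := hv
    obtain ⟨C', hC'⟩ := hw
    refine ⟨C + C', fun l => ?_⟩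
    have : character (σ l) (v + w) - 1 = (character (σ l) v - 1) * character (σ l) w +
        (character (σ l) w - 1) := by rw [character_add]; ring
    rw [this, add_mul]
    refine (norm_add_le _ _).trans (add_le_add ?_ (hC' l))
    rw [norm_mul, F.norm_character_of_mem _ hwm, mul_one]
    exact hC l
  | neg v hvm hv =>
    obtain ⟨C, hC⟩ := hv
    refine ⟨C, fun l => ?_⟩
    have h1 : character (σ l) v * character (σ l) (-v) = 1 := by
      rw [← character_add, add_neg_cancel, character_zero]
    have : character (σ l) (-v) - 1 = -((character (σ l) v - 1) * character (σ l) (-v)) := by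
      rw [sub_mul, h1]; ring
    rw [this, norm_neg, norm_mul, F.norm_character_of_mem _ (neg_mem hvm), mul_one]
    exact hC l

theorem exists_eq_mulVec {v : Fin m ⊕ Fin k → ℂ} (hv : v ∈ F.subgroup) :
    ∃ c : Fin k ⊕ (Fin m ⊕ Fin m) → ℤ, v = F.periodMatrix.mulVec (fun j => ((c j : ℝ) : ℂ)) := by
  induction hv using AddSubgroup.closure_induction with
  | mem v hv =>
    obtain ⟨j, rfl⟩ := hv
    refine ⟨Pi.single j 1, ?_⟩
    rw [← Matrix.mulVec_single_one]
    congr 1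
    funext i
    by_cases h : i = j
    · subst h; simp
    · simp [h]
  | zero => exact ⟨0, by ext; simp [Matrix.mulVec, dotProduct]⟩
  | add v w _ _ hv hw =>
    obtain ⟨c, rfl⟩ := hv
    obtain ⟨d, rfl⟩ := hw
    refine ⟨c + d, ?_⟩
    rw [← Matrix.mulVec_add]
    congr 1
    funext j; simp
  | neg v _ hv =>
    obtain ⟨c, rfl⟩ := hv
    refine ⟨-c, ?_⟩
    rw [← Matrix.mulVec_neg]
    congr 1
    funext j; simp

/-- The real linear combinations of the columns of the period matrix. -/
def realCombination : (Fin k ⊕ (Fin m ⊕ Fin m) → ℝ) →ₗ[ℝ] (Fin m ⊕ Fin k → ℂ) where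
  toFun c := F.periodMatrix.mulVec (fun j => (c j : ℂ))
  map_add' c d := by
    rw [← Matrix.mulVec_add]; congr 1; funext j; simp
  map_smul' a c := by
    ext i
    simp [Matrix.mulVec, dotProduct, Finset.mul_sum, mul_left_comm]

/-- The real linear combinations of the columns of `T`. -/
def realCombinationT : (Fin m ⊕ Fin m → ℝ) →ₗ[ℝ] (Fin m → ℂ) where
  toFun x := F.T.mulVec (fun j => (x j : ℂ))
  map_add' c d := by
    rw [← Matrix.mulVec_add]; congr 1; funext j; simp
  map_smul' a c := by
    ext i
    simp [Matrix.mulVec, dotProduct, Finset.mul_sum, mul_left_comm]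

theorem realCombinationT_injective : Function.Injective F.realCombinationT := by
  refine (injective_iff_map_eq_zero _).2 fun x hx => ?_
  have hi : ∀ i, F.realCombinationT x i = (x (Sum.inl i) : ℂ) +
      ∑ j, ((F.M i j : ℂ) + Complex.I * F.N i j) * x (Sum.inr j) := fun i => by
    simp [realCombinationT, T, Matrix.mulVec, dotProduct]
  simp only [hx, Pi.zero_apply] at hi
  have hN : F.N.mulVec (fun j => x (Sum.inr j)) = 0 := by
    funext i
    have := congrArg Complex.im (hi i)
    simpa [Complex.im_sum, Matrix.mulVec, dotProduct] using this.symm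
  have h2 : (fun j => x (Sum.inr j)) = 0 :=
    Matrix.mulVec_injective_of_isUnit ((Matrix.isUnit_iff_isUnit_det _).2 F.isUnit_det)
      (hN.trans (Matrix.mulVec_zero _).symm)
  funext j
  obtain j | j := j
  · have := hi j
    simp only [fun j => congrFun h2 j] at this
    simpa using this.symm
  · exact congrFun h2 j

theorem realCombinationT_surjective : Function.Surjective F.realCombinationT := by
  refine (LinearMap.injective_iff_surjective_of_finrank_eq_finrank ?_).1
    F.realCombinationT_injective
  rw [← Module.finrank_mul_finrank ℝ ℂ (Fin m → ℂ)]
  simp [Complex.finrank_real_complex]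
  ring

theorem realCombination_injective : Function.Injective F.realCombination := by
  refine (injective_iff_map_eq_zero _).2 fun c hc => ?_
  have h1 : (fun j => c (Sum.inr j)) = 0 := by
    refine (injective_iff_map_eq_zero _).1 F.realCombinationT_injective _ ?_
    funext i
    have := congrFun hc (Sum.inl i)
    simpa [realCombination, realCombinationT, periodMatrix, Matrix.mulVec, dotProduct] using this
  funext j
  obtain j | j := j
  · have := congrFun hc (Sum.inr j)
    simp [realCombination, periodMatrix, Matrix.mulVec, dotProduct,
      Fintype.sum_sum_type (α₁ := Fin k), fun j => congrFun h1 j] at this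
    simpa [Matrix.one_apply] using this
  · exact congrFun h1 j

theorem exists_norm_lt_imp_eq_zero : ∃ ε > 0, ∀ v ∈ F.subgroup, ‖v‖ < ε → v = 0 := by
  obtain ⟨K, hK, hA⟩ := F.realCombination.exists_antilipschitzWith
    (LinearMap.ker_eq_bot.2 F.realCombination_injective)
  refine ⟨(K : ℝ)⁻¹, by positivity, fun v hv hlt => ?_⟩
  obtain ⟨c, rfl⟩ := F.exists_eq_mulVec hv
  have h1 := hA.le_mul_dist (fun j => (c j : ℝ)) 0
  rw [map_zero, dist_zero_right, dist_zero_right] at h1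
  have h2 : ‖(fun j => (c j : ℝ))‖ < 1 := by
    refine h1.trans_lt ?_
    have hK' : (0 : ℝ) < K := hK
    calc (K : ℝ) * _ < K * (K : ℝ)⁻¹ := mul_lt_mul_of_pos_left hlt hK'
      _ = 1 := mul_inv_cancel₀ hK'.ne'
  have h3 : c = 0 := by
    funext j
    have := (norm_le_pi_norm (fun j => (c j : ℝ)) j).trans_lt h2
    rw [Real.norm_eq_abs, ← Int.cast_abs] at this
    exact Int.abs_lt_one_iff.1 (by exact_mod_cast this)
  subst h3
  ext; simp [Matrix.mulVec, dotProduct]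

end NormalForm
end

section
open MeasureTheory

/-! ### Fourier analysis on the torus -/

/-- Differentiation under the integral sign, where Cauchy's estimate on discs of radius `1` provides
the bound on the derivative. -/
theorem differentiable_integral_of_continuous {K : Type*} [TopologicalSpace K] [CompactSpace K]
    [SecondCountableTopology K]
    [MeasurableSpace K] [BorelSpace K] (μ : Measure K) [IsFiniteMeasure μ] {H : K → ℂ → ℂ}
    (hc : Continuous H.uncurry) (hd : ∀ t, Differentiable ℂ (H t)) :
    Differentiable ℂ fun ζ => ∫ t, H t ζ ∂μ := by
  intro ζ₀
  obtain ⟨C, hC⟩ := ((isCompact_univ (X := K)).prod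
    (isCompact_closedBall ζ₀ 2)).exists_bound_of_continuousOn hc.continuousOn
  have hcζ : ∀ ζ, Continuous fun t => H t ζ := fun ζ =>
    hc.comp (continuous_id.prodMk continuous_const)
  have hint : ∀ ζ, AEStronglyMeasurable (fun t => H t ζ) μ := fun ζ =>
    (hcζ ζ).aestronglyMeasurable
  refine (hasDerivAt_integral_of_dominated_loc_of_deriv_le (μ := μ) (F := fun ζ t => H t ζ)
    (F' := fun ζ t => deriv (H t) ζ) (bound := fun _ => C / 1) (Metric.ball_mem_nhds ζ₀ one_pos)
    (.of_forall hint) ?_ ?_ (.of_forall fun t ζ hζ => ?_) (integrable_const _)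
    (.of_forall fun t ζ _ => (hd t ζ).hasDerivAt)).2.differentiableAt
  · exact (hcζ ζ₀).integrable_of_hasCompactSupport (HasCompactSupport.of_compactSpace _)
  · exact ((stronglyMeasurable_deriv_with_param hc).comp_measurable
      (measurable_id.prodMk measurable_const)).aestronglyMeasurable
  · refine Complex.norm_deriv_le_of_forall_mem_sphere_norm_le one_pos (hd t).diffContOnCl
      fun z hz => hC (t, z) ⟨Set.mem_univ _, ?_⟩
    rw [Metric.mem_closedBall]
    have h1 := Metric.mem_ball.1 hζ
    have h2 := Metric.mem_sphere.1 hz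
    linarith [dist_triangle z ζ ζ₀]

theorem mFourier_coe {k : ℕ} (σ : Fin k → ℤ) (x : Fin k → ℝ) :
    UnitAddTorus.mFourier σ (fun i => (x i : UnitAddCircle)) =
      Complex.exp (2 * Real.pi * Complex.I * ∑ i, (σ i : ℂ) * x i) := by
  simp only [UnitAddTorus.mFourier, ContinuousMap.coe_mk, fourier_coe_apply, ← Complex.exp_sum,
    Finset.mul_sum]
  congr 1
  refine Finset.sum_congr rfl fun i _ => ?_
  push_cast; ring

theorem mFourier_apply_add {k : ℕ} (σ : Fin k → ℤ) (s t : UnitAddTorus (Fin k)) :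
    UnitAddTorus.mFourier σ (s + t) = UnitAddTorus.mFourier σ s * UnitAddTorus.mFourier σ t := by
  simp [UnitAddTorus.mFourier, fourier_apply, smul_add, AddCircle.toCircle_add,
    Finset.prod_mul_distrib]

theorem norm_mFourier_apply {k : ℕ} (σ : Fin k → ℤ) (t : UnitAddTorus (Fin k)) :
    ‖UnitAddTorus.mFourier σ t‖ = 1 := by
  simp [UnitAddTorus.mFourier, fourier_apply, Circle.norm_coe]

/-- The normalised Haar measure on the torus. -/
abbrev torusMeasure (k : ℕ) : Measure (UnitAddTorus (Fin k)) :=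
  Measure.pi fun _ => AddCircle.haarAddCircle

theorem integral_mFourier_of_ne_zero {k : ℕ} {σ : Fin k → ℤ} (hσ : σ ≠ 0) :
    ∫ t, UnitAddTorus.mFourier σ t ∂torusMeasure k = 0 := by
  obtain ⟨i, hi⟩ := Function.ne_iff.1 hσ
  let s : UnitAddTorus (Fin k) := fun j =>
    ((Pi.single i (1 / (2 * σ i : ℝ)) : Fin k → ℝ) j : UnitAddCircle)
  -- translation by `s` changes the sign of the monomial
  have hs : UnitAddTorus.mFourier σ s = -1 := by
    have hi' : (σ i : ℂ) ≠ 0 := Int.cast_ne_zero.2 hi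
    have : ∑ j, (σ j : ℂ) * ((Pi.single i (1 / (2 * σ i : ℝ)) : Fin k → ℝ) j : ℝ) = 1 / 2 := by
      rw [Finset.sum_eq_single i]
      · simp; field_simp
      · intro j _ hj; simp [hj]
      · simp
    rw [mFourier_coe, this, ← Complex.exp_pi_mul_I]
    congr 1; ring
  have h := integral_add_left_eq_self (μ := torusMeasure k) (fun t => UnitAddTorus.mFourier σ t) s
  simp only [mFourier_apply_add, hs, neg_one_mul, integral_neg] at h
  exact self_eq_neg.1 h.symm

theorem integral_mFourier_mul_tsum {k : ℕ} {σ : ℕ → Fin k → ℤ} (hinj : Function.Injective σ)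
    {d : ℕ → ℂ} (hd : Summable d) (l : ℕ) :
    ∫ t, UnitAddTorus.mFourier (-σ l) t * ∑' i, d i * UnitAddTorus.mFourier (σ i) t
      ∂torusMeasure k = d l := by
  have hF : ∀ t, UnitAddTorus.mFourier (-σ l) t * ∑' i, d i * UnitAddTorus.mFourier (σ i) t =
      ∑' i, d i * UnitAddTorus.mFourier (-σ l + σ i) t := by
    intro t
    rw [← tsum_mul_left]
    refine tsum_congr fun i => ?_
    rw [UnitAddTorus.mFourier_add]; ring
  have hn : ∀ i, ∫ t, ‖d i * UnitAddTorus.mFourier (-σ l + σ i) t‖ ∂torusMeasure k = ‖d i‖ := by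
    intro i
    simp [norm_mFourier_apply]
  simp only [hF]
  have hint : ∀ i, Integrable (fun t => d i * UnitAddTorus.mFourier (-σ l + σ i) t)
      (torusMeasure k) := fun i =>
    (continuous_const.mul (UnitAddTorus.mFourier _).continuous).integrable_of_hasCompactSupport
      (HasCompactSupport.of_compactSpace _)
  rw [← integral_tsum_of_summable_integral_norm hint (by simpa only [hn] using hd.norm)]
  simp only [integral_const_mul]
  rw [tsum_eq_single l]
  · simp [UnitAddTorus.mFourier_zero]
  · intro i hi
    rw [integral_mFourier_of_ne_zero, mul_zero]
    rw [neg_add_eq_sub]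
    exact sub_ne_zero.2 (hinj.ne hi)

end

namespace NormalForm

variable {m k : ℕ} (F : NormalForm m k)

/-! ### Holomorphic functions on the tube with prescribed translation differences -/

/-- The point with first coordinates `u` and real last coordinates `x`. -/
def realPoint (u : Fin m → ℂ) (x : Fin k → ℝ) : Fin m ⊕ Fin k → ℂ :=
  Sum.elim u fun i => (x i : ℂ)

theorem realPoint_mem_tube {r : ℝ} (hr : 0 < r) (u : Fin m → ℂ) (x : Fin k → ℝ) :
    realPoint u x ∈ tube m k r := fun i => by simpa [realPoint] using hr

theorem character_realPoint (σ : Fin k → ℤ) (u : Fin m → ℂ) (x : Fin k → ℝ) :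
    character σ (realPoint u x) = UnitAddTorus.mFourier σ (fun i => (x i : UnitAddCircle)) := by
  rw [mFourier_coe]; rfl

theorem realPoint_int_mem (ν : Fin k → ℤ) :
    realPoint (0 : Fin m → ℂ) (fun i => (ν i : ℝ)) ∈ F.subgroup := by
  have h : realPoint (0 : Fin m → ℂ) (fun i => (ν i : ℝ)) =
      ∑ i, ν i • F.periodMatrix.col (Sum.inl i) := by
    ext j
    obtain j | j := j
    · simp [realPoint, periodMatrix]
    · simp [realPoint, periodMatrix, Matrix.one_apply]
  rw [h]
  exact sum_mem fun i _ => zsmul_mem (AddSubgroup.subset_closure (Set.mem_range_self _)) _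

theorem col_inr_eq (j : Fin m ⊕ Fin m) :
    F.periodMatrix.col (Sum.inr j) = realPoint (F.T.col j) (F.R.col j) := by
  ext i
  obtain i | i := i <;> simp [realPoint, periodMatrix]

/-- Liouville's theorem for functions multiplied by constants of modulus one under translation by
the columns of `T`: these columns span `ℂᵐ` over `ℝ`, so such a function is bounded. -/
theorem apply_eq_apply_of_equivariant {g : (Fin m → ℂ) → ℂ} (hg : Continuous g)
    (hd : ∀ u v, Differentiable ℂ fun ζ : ℂ => g (u + ζ • v)) {χ : Fin m ⊕ Fin m → ℂ}
    (hχ : ∀ j, ‖χ j‖ = 1) (hT : ∀ j u, g (u + F.T.col j) = χ j * g u) (u v : Fin m → ℂ) :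
    g u = g v := by
  -- the norm of `g` is periodic for the lattice spanned by the columns of `T`
  let P : AddSubgroup (Fin m → ℂ) :=
    { carrier := {v | ∀ u, ‖g (u + v)‖ = ‖g u‖}
      add_mem' := fun {a b} ha hb u => by rw [← add_assoc, hb, ha]
      zero_mem' := fun u => by rw [add_zero]
      neg_mem' := fun {a} ha u => by rw [← ha (u + -a), neg_add_cancel_right] }
  have hP : ∀ j, F.T.col j ∈ P := fun j u => by rw [hT, norm_mul, hχ, one_mul]
  have hcont : Continuous F.realCombinationT := F.realCombinationT.continuous_of_finiteDimensional
  obtain ⟨C, hC⟩ := ((isCompact_univ_pi fun _ : Fin m ⊕ Fin m =>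
    isCompact_Icc (a := (0 : ℝ)) (b := 1)).exists_bound_of_continuousOn
      (hg.comp hcont).continuousOn)
  have hbdd : ∀ u, ‖g u‖ ≤ C := by
    intro u
    obtain ⟨x, rfl⟩ := F.realCombinationT_surjective u
    have hx : F.realCombinationT x = F.realCombinationT (fun j => Int.fract (x j)) +
        ∑ j, ⌊x j⌋ • F.T.col j := by
      have : x = (fun j => Int.fract (x j)) + fun j => (⌊x j⌋ : ℝ) := by
        funext j; exact (Int.fract_add_floor _).symm
      conv_lhs => rw [this]
      rw [map_add]
      congr 1
      funext i
      simp [realCombinationT, Matrix.mulVec, dotProduct, mul_comm]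
    rw [hx, (sum_mem fun j _ => zsmul_mem (hP j) _ : ∑ j, ⌊x j⌋ • F.T.col j ∈ P)]
    exact hC _ fun j _ => ⟨Int.fract_nonneg _, (Int.fract_lt_one _).le⟩
  have hb : Bornology.IsBounded (Set.range fun ζ : ℂ => g (u + ζ • (v - u))) :=
    isBounded_iff_forall_norm_le.2 ⟨C, by rintro _ ⟨ζ, rfl⟩; exact hbdd _⟩
  simpa using (hd u (v - u)).apply_eq_apply_of_bounded hb 0 1

/-- If a holomorphic function on the tube has the translation differences of the formal series
`-∑ₗ c_l χ_{σ_l}`, then the coefficients `c_l` are bounded: up to sign they are Fourier coefficients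
of the function on a compact torus. -/
theorem exists_bound_coefficients {r : ℝ} (hr : 0 < r) {h : (Fin m ⊕ Fin k → ℂ) → ℂ}
    (hh : ∀ w ∈ tube m k r, DifferentiableAt ℂ h w) {σ : ℕ → Fin k → ℤ}
    (hinj : Function.Injective σ)
    (hσ : ∀ l, ∃ j, character (σ l) (F.periodMatrix.col (Sum.inr j)) ≠ 1) {c : ℕ → ℂ}
    (hs : ∀ v ∈ F.subgroup, Summable fun l => c l * (character (σ l) v - 1))
    (heq : ∀ v ∈ F.subgroup, ∀ w ∈ tube m k r,
      h (w + v) - h w = -∑' l, c l * (character (σ l) v - 1) * character (σ l) w) :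
    ∃ C, ∀ l, ‖c l‖ ≤ C := by
  have hcont : ContinuousOn h (tube m k r) := fun w hw => (hh w hw).continuousAt.continuousWithinAt
  have hptc : Continuous fun p : (Fin m → ℂ) × (Fin k → ℝ) => realPoint p.1 p.2 := by
    refine continuous_pi fun i => ?_
    obtain i | i := i <;> simp only [realPoint, Sum.elim_inl, Sum.elim_inr] <;> fun_prop
  -- `h` descends to a function `H` on the product of `ℂᵐ` with the torus
  let q : (Fin k → ℝ) → UnitAddTorus (Fin k) := Pi.map fun _ x => (x : UnitAddCircle)
  have hq : IsOpenQuotientMap q := IsOpenQuotientMap.piMap fun _ =>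
    QuotientAddGroup.isOpenQuotientMap_mk
  let s : UnitAddTorus (Fin k) → (Fin k → ℝ) := Function.surjInv hq.surjective
  have hqs : ∀ t, q (s t) = t := Function.surjInv_eq hq.surjective
  let H : (Fin m → ℂ) → UnitAddTorus (Fin k) → ℂ := fun u t => h (realPoint u (s t))
  have hper : ∀ u x (ν : Fin k → ℤ),
      h (realPoint u (x + fun i => (ν i : ℝ))) = h (realPoint u x) := by
    intro u x ν
    have h1 := heq _ (F.realPoint_int_mem ν) _ (realPoint_mem_tube hr u x)
    have h2 : ∀ l, character (σ l) (realPoint (0 : Fin m → ℂ) (fun i => (ν i : ℝ))) = 1 := by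
      intro l
      rw [character_realPoint, mFourier_coe]
      convert Complex.exp_int_mul_two_pi_mul_I (∑ i, σ l i * ν i) using 2
      push_cast; ring
    simp only [h2, sub_self, mul_zero, zero_mul, tsum_zero, neg_zero] at h1
    rw [← sub_eq_zero, ← h1]
    congr 2
    ext i
    obtain i | i := i <;> simp [realPoint]
  have hH : ∀ u x, H u (q x) = h (realPoint u x) := by
    intro u x
    have h1 : ∀ i, ∃ ν : ℤ, s (q x) i = x i + ν := by
      intro i
      have h2 : ((s (q x) i : ℝ) : UnitAddCircle) = (x i : ℝ) := congrFun (hqs (q x)) i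
      rw [← sub_eq_zero, ← AddCircle.coe_sub, AddCircle.coe_eq_zero_iff] at h2
      obtain ⟨ν, hν⟩ := h2
      exact ⟨ν, by rw [zsmul_one] at hν; linarith⟩
    choose ν hν using h1
    have h2 : s (q x) = x + fun i => (ν i : ℝ) := funext hν
    change h (realPoint u (s (q x))) = _
    rw [h2, hper]
  have hHc : Continuous fun p : (Fin m → ℂ) × UnitAddTorus (Fin k) => H p.1 p.2 := by
    refine ((IsOpenQuotientMap.id.prodMap hq).continuous_comp_iff).1 ?_
    have : (fun p : (Fin m → ℂ) × UnitAddTorus (Fin k) => H p.1 p.2) ∘ Prod.map id q =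
        fun p => h (realPoint p.1 p.2) := funext fun p => hH p.1 p.2
    rw [this]
    exact hcont.comp_continuous hptc fun p => realPoint_mem_tube hr _ _
  let μ := torusMeasure k
  have hint : ∀ {f : UnitAddTorus (Fin k) → ℂ}, Continuous f → MeasureTheory.Integrable f μ :=
    fun hf => hf.integrable_of_hasCompactSupport (HasCompactSupport.of_compactSpace _)
  -- the Fourier coefficients of `H u`
  let g : ℕ → (Fin m → ℂ) → ℂ := fun l u => ∫ t, UnitAddTorus.mFourier (-σ l) t * H u t ∂μ
  have hgc : ∀ l, Continuous (g l) := by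
    intro l
    have := continuous_parametric_integral_of_continuous (μ := μ) (s := Set.univ)
      (f := fun u t => UnitAddTorus.mFourier (-σ l) t * H u t)
      (((UnitAddTorus.mFourier (-σ l)).continuous.comp continuous_snd).mul hHc) isCompact_univ
    simpa using this
  have hgd : ∀ l u v, Differentiable ℂ fun ζ : ℂ => g l (u + ζ • v) := by
    intro l u v
    refine differentiable_integral_of_continuous μ
      (H := fun t ζ => UnitAddTorus.mFourier (-σ l) t * H (u + ζ • v) t) ?_ fun t => ?_
    · refine ((UnitAddTorus.mFourier (-σ l)).continuous.comp continuous_fst).mul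
        (hHc.comp (Continuous.prodMk ?_ continuous_fst))
      fun_prop
    · refine Differentiable.const_mul (fun ζ => ?_) _
      refine DifferentiableAt.comp (g := h) ζ (hh _ (realPoint_mem_tube hr _ _)) ?_
      refine differentiableAt_pi.2 fun i => ?_
      obtain i | i := i
      · simp only [realPoint, Sum.elim_inl, Pi.add_apply, Pi.smul_apply]; fun_prop
      · exact differentiableAt_const _
  have hgT : ∀ l j u, g l (u + F.T.col j) + c l =
      UnitAddTorus.mFourier (-σ l) (q (F.R.col j)) * (g l u + c l) := by
    intro l j u
    set b := q (F.R.col j) with hb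
    have hv : F.periodMatrix.col (Sum.inr j) ∈ F.subgroup :=
      AddSubgroup.subset_closure (Set.mem_range_self _)
    have hχ : ∀ i, character (σ i) (F.periodMatrix.col (Sum.inr j)) =
        UnitAddTorus.mFourier (σ i) b := fun i => by rw [F.col_inr_eq, character_realPoint]; rfl
    have hd := hs _ hv
    simp only [hχ] at hd
    have hshift : ∀ t, H (u + F.T.col j) (b + t) = H u t -
        ∑' i, c i * (UnitAddTorus.mFourier (σ i) b - 1) * UnitAddTorus.mFourier (σ i) t := by
      intro t
      obtain ⟨x, rfl⟩ := hq.surjective t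
      have h1 := heq _ hv _ (realPoint_mem_tube hr u x)
      have h2 : realPoint u x + F.periodMatrix.col (Sum.inr j) =
          realPoint (u + F.T.col j) (F.R.col j + x) := by
        rw [F.col_inr_eq]
        ext i
        obtain i | i := i <;> simp [realPoint, add_comm]
      have h3 : b + q x = q (F.R.col j + x) := rfl
      rw [h3, hH, hH, ← h2, eq_add_of_sub_eq h1, sub_eq_neg_add]
      simp only [hχ, character_realPoint]
      rfl
    have hS : Continuous fun t => ∑' i, c i * (UnitAddTorus.mFourier (σ i) b - 1) *
        UnitAddTorus.mFourier (σ i) t :=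
      continuous_tsum (fun i => continuous_const.mul (UnitAddTorus.mFourier (σ i)).continuous)
        hd.norm fun i t => by rw [norm_mul, norm_mFourier_apply, mul_one]
    have hinv : UnitAddTorus.mFourier (-σ l) b * UnitAddTorus.mFourier (σ l) b = 1 := by
      rw [← UnitAddTorus.mFourier_add, neg_add_cancel, UnitAddTorus.mFourier_zero]; rfl
    have hi₁ : MeasureTheory.Integrable (fun t => UnitAddTorus.mFourier (-σ l) t * H u t) μ :=
      hint ((UnitAddTorus.mFourier (-σ l)).continuous.mul
        (hHc.comp (continuous_const.prodMk continuous_id)))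
    have hi₂ : MeasureTheory.Integrable (fun t => UnitAddTorus.mFourier (-σ l) t *
        ∑' i, c i * (UnitAddTorus.mFourier (σ i) b - 1) * UnitAddTorus.mFourier (σ i) t) μ :=
      hint ((UnitAddTorus.mFourier (-σ l)).continuous.mul hS)
    calc g l (u + F.T.col j) + c l
        = ∫ t, UnitAddTorus.mFourier (-σ l) (b + t) * H (u + F.T.col j) (b + t) ∂μ + c l := by
          rw [MeasureTheory.integral_add_left_eq_self (μ := μ)
            (fun t => UnitAddTorus.mFourier (-σ l) t * H (u + F.T.col j) t) b]
      _ = UnitAddTorus.mFourier (-σ l) b * (g l u -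
            c l * (UnitAddTorus.mFourier (σ l) b - 1)) + c l := by
          rw [← integral_mFourier_mul_tsum hinj hd l, ← MeasureTheory.integral_sub hi₁ hi₂,
            ← MeasureTheory.integral_const_mul]
          congr 2
          funext t
          rw [mFourier_apply_add, hshift]
          ring
      _ = _ := by linear_combination (-c l) * hinv
  -- `g l + c l` is constant, and zero since one of its multipliers is not `1`
  have hg : ∀ l, g l 0 = -c l := by
    intro l
    obtain ⟨j, hj⟩ := hσ l
    have h1 := F.apply_eq_apply_of_equivariant (g := fun u => g l u + c l)
      ((hgc l).add continuous_const)
      (fun u v => (hgd l u v).add_const _) (fun j => norm_mFourier_apply _ _) (hgT l)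
      (0 + F.T.col j) 0
    have h2 := hgT l j 0
    rw [h1] at h2
    by_contra hne
    have hne' : g l 0 + c l ≠ 0 := fun h => hne (eq_neg_of_add_eq_zero_left h)
    have h3 := mul_right_cancel₀ hne' ((one_mul _).trans h2)
    rw [UnitAddTorus.mFourier_neg] at h3
    refine hj ?_
    rw [F.col_inr_eq, character_realPoint]
    have h4 : UnitAddTorus.mFourier (σ l) (q (F.R.col j)) = 1 := by
      simpa using (congrArg (starRingEnd ℂ) h3).symm
    exact h4
  obtain ⟨C, hC⟩ := (isCompact_univ (X := UnitAddTorus (Fin k))).exists_bound_of_continuousOn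
    (f := H 0) (hHc.comp (continuous_const.prodMk continuous_id)).continuousOn
  refine ⟨C, fun l => ?_⟩
  rw [← norm_neg, ← hg l]
  refine (MeasureTheory.norm_integral_le_of_norm_le_const (C := C)
    (.of_forall fun t => ?_)).trans ?_
  · rw [norm_mul, norm_mFourier_apply, one_mul]
    exact hC t (Set.mem_univ _)
  · simp [μ]

/-! ### Resonant sequences -/

/-- On a Cousin group a nontrivial character cannot be `Λ`-periodic. It is `1` at the first `k`
columns of the period matrix, so it differs from `1` at one of the last `2m`. -/
theorem character_ne_one_of_isCousin {n : ℕ} {Λ : AddSubgroup (Fin n → ℂ)} (hX : IsCousin Λ)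
    (φ : (Fin n → ℂ) ≃ₗ[ℂ] (Fin m ⊕ Fin k → ℂ)) (hφ : Λ.map φ.toAddMonoidHom = F.subgroup)
    {σ : Fin k → ℤ} (hσ : σ ≠ 0) :
    ∃ j, character σ (F.periodMatrix.col (Sum.inr j)) ≠ 1 := by
  by_contra! hall
  have h1 : ∀ v ∈ F.subgroup, character σ v = 1 := by
    intro v hv
    induction hv using AddSubgroup.closure_induction with
    | mem v hv =>
      obtain ⟨i | j, rfl⟩ := hv
      · exact F.character_col_inl σ i
      · exact hall j
    | zero => exact character_zero σ
    | add v w _ _ hv hw => rw [character_add, hv, hw, one_mul]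
    | neg v _ hv =>
      have := character_add σ v (-v)
      rwa [add_neg_cancel, character_zero, hv, one_mul, eq_comm] at this
  let f : GroupQuotient Λ → ℂ := Quotient.lift (fun z => character σ (φ z)) fun z w hzw => by
    have h2 : w - z ∈ Λ := sub_mem_of_proj_eq Λ (Quotient.sound hzw)
    have h3 : φ (w - z) ∈ F.subgroup := hφ ▸ AddSubgroup.mem_map_of_mem _ h2
    have h4 : φ w = φ z + φ (w - z) := by rw [← map_add, add_sub_cancel]
    change character σ (φ z) = character σ (φ w)
    rw [h4, character_add, h1 _ h3, mul_one]
  have hf : Differentiable ℂ (f ∘ proj Λ) := fun z =>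
    (hasFDerivAt_character σ (φ z)).differentiableAt.comp z
      φ.toContinuousLinearEquiv.differentiableAt
  obtain ⟨i, hi⟩ := Function.ne_iff.1 hσ
  have hi' : (σ i : ℂ) ≠ 0 := Int.cast_ne_zero.2 hi
  have h5 : character σ (φ (φ.symm (Pi.single (Sum.inr i) (1 / (2 * σ i))))) =
      character σ (φ 0) := hX f hf (proj Λ _) (proj Λ 0)
  have h6 : ∑ j, (σ j : ℂ) *
      (Pi.single (Sum.inr i) (1 / (2 * σ i)) : Fin m ⊕ Fin k → ℂ) (Sum.inr j) = 1 / 2 := by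
    rw [Finset.sum_eq_single i]
    · simp; field_simp
    · intro j _ hj; simp [hj]
    · simp
  rw [map_zero, character_zero, LinearEquiv.apply_symm_apply, character, h6] at h5
  have h7 : Complex.exp (2 * Real.pi * Complex.I * (1 / 2)) = -1 := by
    rw [← Complex.exp_pi_mul_I]; congr 1; ring
  rw [h7] at h5
  norm_num at h5

/-- The rows `ᵗσ_l R` are within `a^|σ_l|` of an integral row: strong dispersiveness fails
along `σ`. -/
def IsResonant (a : ℝ) (σ : ℕ → Fin k → ℤ) : Prop :=
  ∀ l, ∃ τ : Fin m ⊕ Fin m → ℤ,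
    ‖Matrix.vecMul (fun i => (σ l i : ℝ)) F.R + fun j => (τ j : ℝ)‖ ≤ a ^ (∑ i, (σ l i).natAbs)

/-- Each of the finitely many `σ ≠ 0` with `|σ| ≤ L` keeps `ᵗσ R` at a positive distance from the
integral rows, so violating the bound with a small constant `C` forces `|σ| > L`. -/
theorem exists_isResonant
    (hF : ∀ σ : Fin k → ℤ, σ ≠ 0 → ∃ j, character σ (F.periodMatrix.col (Sum.inr j)) ≠ 1)
    (h : ¬F.StronglyDispersive) :
    ∃ a : ℝ, 0 < a ∧ a < 1 ∧ ∃ σ : ℕ → Fin k → ℤ, (∀ l, σ l ≠ 0) ∧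
      StrictMono (fun l => ∑ i, (σ l i).natAbs) ∧ F.IsResonant a σ := by
  unfold StronglyDispersive at h
  push Not at h
  obtain ⟨a, ha0, ha1, h⟩ := h
  refine ⟨a, ha0, ha1, ?_⟩
  have hfreq : ∃ᶠ N in Filter.atTop, ∃ σ : Fin k → ℤ, σ ≠ 0 ∧ ∑ i, (σ i).natAbs = N ∧
      ∃ τ : Fin m ⊕ Fin m → ℤ,
        ‖Matrix.vecMul (fun i => (σ i : ℝ)) F.R + fun j => (τ j : ℝ)‖ ≤ a ^ N := by
    rw [Filter.frequently_atTop]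
    intro L
    have hfin : {σ : Fin k → ℤ | ∑ i, (σ i).natAbs ≤ L}.Finite := by
      refine (Set.finite_Icc (fun _ => -(L : ℤ)) (fun _ => (L : ℤ))).subset fun σ hσ => ?_
      have : ∀ i, |σ i| ≤ L := fun i => by
        have h1 := (Finset.single_le_sum (f := fun i => (σ i).natAbs) (fun _ _ => Nat.zero_le _)
          (Finset.mem_univ i)).trans hσ
        rw [Int.abs_eq_natAbs]; exact_mod_cast h1
      exact ⟨fun i => (abs_le.1 (this i)).1, fun i => (abs_le.1 (this i)).2⟩
    have hsmall : ∀ᶠ C : ℝ in 𝓝[>] 0, ∀ σ ∈ {σ : Fin k → ℤ | ∑ i, (σ i).natAbs ≤ L}, σ ≠ 0 →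
        ∀ τ : Fin m ⊕ Fin m → ℤ,
          C < ‖Matrix.vecMul (fun i => (σ i : ℝ)) F.R + fun j => (τ j : ℝ)‖ := by
      rw [Filter.eventually_all_finite hfin]
      intro σ _
      by_cases hσ : σ = 0
      · exact .of_forall fun C h => absurd hσ h
      obtain ⟨j, hj⟩ := hF σ hσ
      have hpos : 0 < ‖character σ (F.periodMatrix.col (Sum.inr j)) - 1‖ / (2 * Real.pi) :=
        div_pos (norm_pos_iff.2 (sub_ne_zero.2 hj)) (by positivity)
      filter_upwards [Ioo_mem_nhdsGT hpos] with C hC _ τ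
      refine hC.2.trans_le ((div_le_iff₀' (by positivity)).2 ?_)
      exact F.norm_character_col_inr_sub_one_le σ τ j
    obtain ⟨C, hC, hC0, hC1⟩ := (hsmall.and (Ioo_mem_nhdsGT one_pos)).exists
    obtain ⟨σ, hσ, τ, hτ⟩ := h C hC0
    refine ⟨∑ i, (σ i).natAbs, ?_, σ, hσ, rfl, τ, ?_⟩
    · by_contra! hlt
      have h1 := hC σ hlt.le hσ τ
      have h2 : C * a ^ (∑ i, (σ i).natAbs) ≤ C :=
        mul_le_of_le_one_right hC0.le (pow_le_one₀ ha0.le ha1.le)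
      linarith
    · exact hτ.le.trans (mul_le_of_le_one_left (by positivity) hC1.le)
  obtain ⟨N, hN, hP⟩ := Filter.extraction_of_frequently_atTop hfreq
  choose σ hσ hσN hτ using hP
  refine ⟨σ, hσ, ?_, fun l => ?_⟩
  · simpa only [hσN] using hN
  · rw [hσN]; exact hτ l

end NormalForm

/-! ### The formal primitives -/

section
variable {n m k : ℕ} {Λ : AddSubgroup (Fin n → ℂ)} {F : NormalForm m k}
  {φ : (Fin n → ℂ) ≃ₗ[ℂ] (Fin m ⊕ Fin k → ℂ)} {a r : ℝ} {σ : ℕ → Fin k → ℤ}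

theorem apply_mem_subgroup_iff (hφ : Λ.map φ.toAddMonoidHom = F.subgroup) {v : Fin n → ℂ} :
    φ v ∈ F.subgroup ↔ v ∈ Λ := by
  rw [← hφ]
  exact AddSubgroup.mem_map_iff_mem (f := φ.toAddMonoidHom) φ.injective

theorem exists_norm_lt_imp_eq_zero_of_map (hφ : Λ.map φ.toAddMonoidHom = F.subgroup) :
    ∃ ε > 0, ∀ v ∈ Λ, ‖v‖ < ε → v = 0 := by
  obtain ⟨ε, hε, h⟩ := F.exists_norm_lt_imp_eq_zero
  have h1 : ∀ᶠ v in 𝓝 (0 : Fin n → ℂ), ‖φ v‖ < ε :=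
    φ.toContinuousLinearEquiv.continuous.norm.continuousAt.eventually_lt continuousAt_const
      (by simpa using hε)
  obtain ⟨δ, hδ, hball⟩ := Metric.eventually_nhds_iff.1 h1
  refine ⟨δ, hδ, fun v hv hlt =>
    φ.map_eq_zero_iff.1 (h _ ((apply_mem_subgroup_iff hφ).2 hv) (hball ?_))⟩
  rwa [dist_zero_right]

theorem isOpen_preimage_tube (φ : (Fin n → ℂ) ≃ₗ[ℂ] (Fin m ⊕ Fin k → ℂ)) (r : ℝ) :
    IsOpen (φ ⁻¹' tube m k r) :=
  (isOpen_tube r).preimage φ.toContinuousLinearEquiv.continuous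

/-- The image in `ℂⁿ/Λ` of the tube, read in the coordinates `φ`. -/
def tubeQuotient (Λ : AddSubgroup (Fin n → ℂ)) (φ : (Fin n → ℂ) ≃ₗ[ℂ] (Fin m ⊕ Fin k → ℂ))
    (r : ℝ) : Opens (GroupQuotient Λ) :=
  ⟨proj Λ '' (φ ⁻¹' tube m k r), isOpenMap_proj Λ _ (isOpen_preimage_tube φ r)⟩

theorem proj_mem_tubeQuotient_iff (hφ : Λ.map φ.toAddMonoidHom = F.subgroup) {z : Fin n → ℂ} :
    proj Λ z ∈ tubeQuotient Λ φ r ↔ φ z ∈ tube m k r := by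
  refine ⟨?_, fun h => ⟨z, h, rfl⟩⟩
  rintro ⟨w, hw, hwz⟩
  have h1 := (apply_mem_subgroup_iff hφ).2 (sub_mem_of_proj_eq Λ hwz)
  have h2 : φ z = φ w + φ (z - w) := by rw [← map_add, add_sub_cancel]
  rw [h2, F.add_mem_tube_iff h1]
  exact hw

theorem convex_preimage_tubeQuotient (hφ : Λ.map φ.toAddMonoidHom = F.subgroup) :
    Convex ℝ (proj Λ ⁻¹' (tubeQuotient Λ φ r : Set (GroupQuotient Λ))) := by
  have h : proj Λ ⁻¹' (tubeQuotient Λ φ r : Set (GroupQuotient Λ)) = φ ⁻¹' tube m k r :=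
    Set.ext fun _ => proj_mem_tubeQuotient_iff hφ
  rw [h]
  exact (convex_tube r).linear_preimage (φ.toLinearMap.restrictScalars ℝ)

/-- Small divisors beat the growth of the characters on the tube: `|χ_σ(v) - 1|` is `O(a^|σ|)`
along a resonant sequence, while `|χ_σ|` is at most `exp(2πr)^|σ|` on the tube. -/
theorem summable_pow_mul_norm_character_sub_one (ha : 0 < a)
    (har : a * Real.exp (2 * Real.pi * r) < 1)
    (hN : Function.Injective fun l => ∑ i, (σ l i).natAbs) (hσ : F.IsResonant a σ) (p : ℕ)
    {v : Fin m ⊕ Fin k → ℂ} (hv : v ∈ F.subgroup) :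
    Summable fun l => ((∑ i, (σ l i).natAbs : ℕ) : ℝ) ^ p * ‖character (σ l) v - 1‖ *
      Real.exp (2 * Real.pi * r) ^ (∑ i, (σ l i).natAbs) := by
  obtain ⟨C, hC⟩ := F.exists_norm_character_sub_one_le hσ hv
  have h1 : ‖a * Real.exp (2 * Real.pi * r)‖ < 1 := by
    rwa [Real.norm_of_nonneg (by positivity)]
  have h2 := ((summable_pow_mul_geometric_of_norm_lt_one p h1).comp_injective hN).mul_left C
  refine Summable.of_nonneg_of_le (fun l => by positivity) (fun l => ?_) h2
  simp only [Function.comp]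
  calc _ ≤ ((∑ i, (σ l i).natAbs : ℕ) : ℝ) ^ p * (C * a ^ (∑ i, (σ l i).natAbs)) *
      Real.exp (2 * Real.pi * r) ^ (∑ i, (σ l i).natAbs) := by
        gcongr; exact hC l
    _ = _ := by rw [mul_pow]; ring

theorem summable_pow_mul_character_add_sub (ha : 0 < a)
    (har : a * Real.exp (2 * Real.pi * r) < 1)
    (hN : Function.Injective fun l => ∑ i, (σ l i).natAbs) (hσ : F.IsResonant a σ) (p : ℕ)
    {v w : Fin m ⊕ Fin k → ℂ} (hv : v ∈ F.subgroup) (hw : w ∈ tube m k r) :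
    Summable fun l => ((∑ i, (σ l i).natAbs : ℕ) : ℂ) ^ p *
      (character (σ l) (w + v) - character (σ l) w) := by
  refine Summable.of_norm_bounded (summable_pow_mul_norm_character_sub_one ha har hN hσ p hv)
    fun l => ?_
  have h1 : character (σ l) (w + v) - character (σ l) w =
      (character (σ l) v - 1) * character (σ l) w := by rw [character_add]; ring
  rw [h1, norm_mul, norm_mul, norm_pow, Complex.norm_natCast, ← mul_assoc]
  gcongr
  exact norm_character_le _ fun i => (hw i).le

/-- The formal series `∑ |σ_l|ᵖ χ_{σ_l}`, which diverges, made convergent on the tube by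
subtracting from each term its value at a representative, chosen once and for all, of the class
modulo `Λ`. The subtracted term is `Λ`-periodic, but in general not continuous. -/
def formalPrimitive (Λ : AddSubgroup (Fin n → ℂ)) (φ : (Fin n → ℂ) ≃ₗ[ℂ] (Fin m ⊕ Fin k → ℂ))
    (σ : ℕ → Fin k → ℤ) (p : ℕ) (z : Fin n → ℂ) : ℂ :=
  ∑' l, ((∑ i, (σ l i).natAbs : ℕ) : ℂ) ^ p *
    (character (σ l) (φ z) - character (σ l) (φ (Quotient.out (proj Λ z))))

theorem summable_formalPrimitive (ha : 0 < a) (har : a * Real.exp (2 * Real.pi * r) < 1)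
    (hN : Function.Injective fun l => ∑ i, (σ l i).natAbs) (hσ : F.IsResonant a σ)
    (hφ : Λ.map φ.toAddMonoidHom = F.subgroup) (p : ℕ) {z : Fin n → ℂ} (hz : φ z ∈ tube m k r) :
    Summable fun l => ((∑ i, (σ l i).natAbs : ℕ) : ℂ) ^ p *
      (character (σ l) (φ z) - character (σ l) (φ (Quotient.out (proj Λ z)))) := by
  have hrep : proj Λ (Quotient.out (proj Λ z)) = proj Λ z := Quotient.out_eq _
  have h1 := summable_pow_mul_character_add_sub ha har hN hσ p
    ((apply_mem_subgroup_iff hφ).2 (sub_mem_of_proj_eq Λ hrep))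
    ((proj_mem_tubeQuotient_iff hφ).1 (hrep ▸ (proj_mem_tubeQuotient_iff hφ).2 hz))
  simpa only [← map_add, add_sub_cancel] using h1

theorem formalPrimitive_add_sub (ha : 0 < a) (har : a * Real.exp (2 * Real.pi * r) < 1)
    (hN : Function.Injective fun l => ∑ i, (σ l i).natAbs) (hσ : F.IsResonant a σ)
    (hφ : Λ.map φ.toAddMonoidHom = F.subgroup) (p : ℕ) {v z : Fin n → ℂ} (hv : v ∈ Λ)
    (hz : φ z ∈ tube m k r) :
    formalPrimitive Λ φ σ p (z + v) - formalPrimitive Λ φ σ p z =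
      ∑' l, ((∑ i, (σ l i).natAbs : ℕ) : ℂ) ^ p * (character (σ l) (φ v) - 1) *
        character (σ l) (φ z) := by
  have hz' : φ (z + v) ∈ tube m k r := by
    rwa [map_add, F.add_mem_tube_iff ((apply_mem_subgroup_iff hφ).2 hv)]
  have hs := summable_formalPrimitive ha har hN hσ hφ p hz'
  rw [formalPrimitive, formalPrimitive,
    ← hs.tsum_sub (summable_formalPrimitive ha har hN hσ hφ p hz)]
  refine tsum_congr fun l => ?_
  rw [proj_add Λ hv, map_add, character_add]
  ring

theorem formalPrimitive_mem_quasiperiodic (ha : 0 < a) (hr : 0 < r)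
    (har : a * Real.exp (2 * Real.pi * r) < 1)
    (hN : Function.Injective fun l => ∑ i, (σ l i).natAbs) (hσ : F.IsResonant a σ)
    (hφ : Λ.map φ.toAddMonoidHom = F.subgroup) (p : ℕ) :
    formalPrimitive Λ φ σ p ∈ quasiperiodic Λ (tubeQuotient Λ φ r) := by
  intro v hv z hz
  have hz' := (proj_mem_tubeQuotient_iff hφ).1 hz
  have hv' := (apply_mem_subgroup_iff hφ).2 hv
  have h1 : DifferentiableAt ℂ (fun w => ∑' l, ((∑ i, (σ l i).natAbs : ℕ) : ℂ) ^ p *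
      (character (σ l) (φ v) - 1) * character (σ l) w) (φ z) := by
    refine differentiableAt_tsum_character hr ?_ ?_ hz'
    · refine (summable_pow_mul_norm_character_sub_one ha har hN hσ (p + 1) hv').congr fun l => ?_
      rw [norm_mul, norm_pow, Complex.norm_natCast]
      ring
    · simpa [character_zero] using
        summable_pow_mul_character_add_sub ha har hN hσ p hv' (zero_mem_tube hr)
  refine (h1.comp z φ.toContinuousLinearEquiv.differentiableAt).congr_of_eventuallyEq ?_
  filter_upwards [(isOpen_preimage_tube φ r).mem_nhds hz'] with w hw
  exact formalPrimitive_add_sub ha har hN hσ hφ p hv hw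

/-- A nontrivial combination of the primitives with exponents `p ≥ 1` would, if its class in `H¹`
vanished, make the values at `|σ_l| → ∞` of a nonconstant polynomial bounded. -/
theorem not_finiteDimensional_of_isResonant (ha : 0 < a) (hr : 0 < r)
    (har : a * Real.exp (2 * Real.pi * r) < 1)
    (hN : StrictMono fun l => ∑ i, (σ l i).natAbs) (hσ : F.IsResonant a σ)
    (hφ : Λ.map φ.toAddMonoidHom = F.subgroup)
    (hne : ∀ l, ∃ j, character (σ l) (F.periodMatrix.col (Sum.inr j)) ≠ 1) :
    ¬FiniteDimensional ℂ (H1 Λ (tubeQuotient Λ φ r)) := by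
  intro hfd
  set N : ℕ → ℕ := fun l => ∑ i, (σ l i).natAbs
  have hmem : ∀ {z}, proj Λ z ∈ tubeQuotient Λ φ r ↔ φ z ∈ tube m k r :=
    proj_mem_tubeQuotient_iff hφ
  -- the exponent `p + 1` avoids the constant polynomial, whose values stay bounded
  obtain ⟨c, hc0, f, hf⟩ := exists_combination_pullback Λ (exists_norm_lt_imp_eq_zero_of_map hφ)
    (tubeQuotient Λ φ r) fun p =>
      formalPrimitive_mem_quasiperiodic ha hr har hN.injective hσ hφ (p + 1)
  -- the holomorphic function obtained, in normal coordinates, and the polynomial `P` such that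
  -- its translation differences are those of `-∑ P(|σ_l|) χ_{σ_l}`
  let h : (Fin m ⊕ Fin k → ℂ) → ℂ := fun w =>
    f (proj Λ (φ.symm w)) - c.sum fun p b => b * formalPrimitive Λ φ σ (p + 1) (φ.symm w)
  let P : Polynomial ℂ := c.sum fun p b => Polynomial.monomial (p + 1) b
  have hPeval : ∀ x : ℂ, P.eval x = c.sum fun p b => b * x ^ (p + 1) := fun x => by
    simp [P, Finsupp.sum, Polynomial.eval_finsetSum]
  have hhd : ∀ w ∈ tube m k r, DifferentiableAt ℂ h w := by
    intro w hw
    have h1 := hf (φ.symm w) (hmem.2 (by rwa [LinearEquiv.apply_symm_apply]))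
    exact h1.comp w φ.symm.toContinuousLinearEquiv.differentiableAt
  have hs : ∀ v ∈ F.subgroup, ∀ w ∈ tube m k r, ∀ p,
      Summable fun l => (N l : ℂ) ^ (p + 1) * (character (σ l) v - 1) * character (σ l) w := by
    intro v hv w hw p
    refine (summable_pow_mul_character_add_sub ha har hN.injective hσ (p + 1) hv hw).congr
      fun l => ?_
    rw [character_add]; ring
  have hPw : ∀ (v w : Fin m ⊕ Fin k → ℂ) l,
      P.eval (N l : ℂ) * (character (σ l) v - 1) * character (σ l) w = ∑ p ∈ c.support, c p *
        ((N l : ℂ) ^ (p + 1) * (character (σ l) v - 1) * character (σ l) w) := by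
    intro v w l
    rw [hPeval, Finsupp.sum, Finset.sum_mul, Finset.sum_mul]
    exact Finset.sum_congr rfl fun p _ => by ring
  have hPs : ∀ v ∈ F.subgroup,
      Summable fun l => P.eval (N l : ℂ) * (character (σ l) v - 1) := by
    intro v hv
    have h1 := summable_sum (s := c.support) fun p _ =>
      (hs v hv 0 (zero_mem_tube hr) p).mul_left (c p)
    refine h1.congr fun l => (hPw v 0 l).symm.trans ?_
    rw [character_zero, mul_one]
  have heq : ∀ v ∈ F.subgroup, ∀ w ∈ tube m k r, h (w + v) - h w =
      -∑' l, P.eval (N l : ℂ) * (character (σ l) v - 1) * character (σ l) w := by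
    intro v hv w hw
    have hv' : φ.symm v ∈ Λ :=
      (apply_mem_subgroup_iff hφ).1 (by rwa [LinearEquiv.apply_symm_apply])
    have hΦ : ∀ p, formalPrimitive Λ φ σ (p + 1) (φ.symm w + φ.symm v) =
        formalPrimitive Λ φ σ (p + 1) (φ.symm w) +
        ∑' l, (N l : ℂ) ^ (p + 1) * (character (σ l) v - 1) * character (σ l) w := fun p => by
      have := formalPrimitive_add_sub ha har hN.injective hσ hφ (p + 1) (z := φ.symm w) hv'
        (by rwa [LinearEquiv.apply_symm_apply])
      rw [LinearEquiv.apply_symm_apply, LinearEquiv.apply_symm_apply] at this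
      rw [← this, add_sub_cancel]
    simp only [hPw]
    rw [Summable.tsum_finsetSum fun p _ => (hs v hv w hw p).mul_left (c p)]
    simp only [h, map_add, proj_add Λ hv', hΦ, Finsupp.sum, mul_add, Finset.sum_add_distrib,
      tsum_mul_left]
    ring
  obtain ⟨C, hC⟩ := F.exists_bound_coefficients hr hhd
    (fun l l' hll => hN.injective (congrArg (fun s => ∑ i, (s i).natAbs) hll)) hne hPs heq
  have hdeg : 0 < P.degree := by
    obtain ⟨q, hq⟩ := Finsupp.ne_iff.1 hc0
    have hcoeff : P.coeff (q + 1) = c q := by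
      simp only [P, Finsupp.sum, Polynomial.finsetSum_coeff, Polynomial.coeff_monomial]
      simpa using fun h => h.symm
    refine Polynomial.natDegree_pos_iff_degree_pos.1 ((Nat.succ_pos q).trans_le ?_)
    exact Polynomial.le_natDegree_of_ne_zero (hcoeff ▸ hq)
  have htop := Polynomial.tendsto_norm_atTop P hdeg (l := Filter.atTop)
    (z := fun l => (N l : ℂ)) (by
      simp only [Complex.norm_natCast]
      exact tendsto_natCast_atTop_atTop.comp hN.tendsto_atTop)
  obtain ⟨l, hl⟩ := (htop.eventually_gt_atTop C).exists
  exact hl.not_ge (hC l)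

end
end CousinGroup
end

theorem theorem3p3 {n m : ℕ} (hm : 1 ≤ m) (hmn : m ≤ n) (Λ : AddSubgroup (Fin n → ℂ))
    (hX : CousinGroup.IsCousin Λ)
    (F : CousinGroup.NormalForm m (n - m)) (hF : F.IsNormalFormOf Λ)
    (hH : ∀ U : TopologicalSpace.Opens (CousinGroup.GroupQuotient Λ),
      Convex ℝ (CousinGroup.proj Λ ⁻¹' (U : Set (CousinGroup.GroupQuotient Λ))) →
        FiniteDimensional ℂ (CousinGroup.H1 Λ U)) :
    F.StronglyDispersive := by
  obtain ⟨φ, hφ⟩ := hF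
  by_contra hnot
  have hne := fun σ hσ => F.character_ne_one_of_isCousin hX φ hφ (σ := σ) hσ
  obtain ⟨a, ha0, ha1, σ, hσ0, hmono, hσ⟩ := F.exists_isResonant hne hnot
  -- `r` is chosen such that `exp (2πr) = 1 / √a`
  obtain ⟨r, hr, har⟩ : ∃ r : ℝ, 0 < r ∧ a * Real.exp (2 * Real.pi * r) < 1 := by
    have hlog := Real.log_neg ha0 ha1
    refine ⟨-Real.log a / (4 * Real.pi), div_pos (neg_pos.2 hlog) (by positivity), ?_⟩
    have : 2 * Real.pi * (-Real.log a / (4 * Real.pi)) = -Real.log a / 2 := by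
      field_simp; ring
    rw [this]
    nth_rewrite 1 [← Real.exp_log ha0]
    rw [← Real.exp_add, Real.exp_lt_one_iff]
    linarith
  exact CousinGroup.not_finiteDimensional_of_isResonant ha0 hr har hmono hσ hφ
    (fun l => hne _ (hσ0 l)) (hH _ (CousinGroup.convex_preimage_tubeQuotient hφ))
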